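/- Let $n\ge 3$, let $(\mathbb S^n,g_{\mathbb S^n})$ be the unit sphere in $\mathbb R^{n+1}$ with the round metric, let $dV$, $\nabla$, $|\cdot|$ denote its volume measure, gradient and norm, and let $V>0$. (a) For every real $q\in\left[1,\frac{4n}{3n-2}\right)$ there is a constant $C=C(n,V,q)$ such that for every smooth function $f:\mathbb S^n\to\mathbb R$ for which the conformal metric $g=e^{2f}g_{\mathbb S^n}$ has nonnegative scalar curvature and $\mathrm{Vol}_g(\mathbb S^n)\le V$, one has $$\int_{\mathbb S^n}\left|\nabla e^{\frac{(n-2)f}{2}}\right|^q\,dV\le C .$$ (b) Let $f_j:\mathbb S^n\to\mathbb R$, $j\in\mathbb N$, be smooth functions such that the metrics $g_j=e^{2f_j}g_{\mathbb S^n}$ have nonnegative scalar curvature and $\mathrm{Vol}_{g_j}(\mathbb S^n)\le V$ for all $j$. Then there are a subsequence $(f_{j_k})_k$ and a function $f_\infty:\mathbb S^n\to[-\infty,\infty)$ such that, with the convention $e^{-\infty}=0$, - for every $q\in\left[1,\frac{4n}{3n-2}\right)$, $e^{\frac{(n-2)f_\infty}{2}}\in W^{1,q}(\mathbb S^n,g_{\mathbb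 S^n})$ and $e^{\frac{(n-2)f_{j_k}}{2}}\rightharpoonup e^{\frac{(n-2)f_\infty}{2}}$ weakly in $W^{1,q}(\mathbb S^n,g_{\mathbb S^n})$ as $k\to\infty$; - for every $p\in\left[1,\frac{2n}{n-2}\right)$, $e^{\frac{(n-2)f_\infty}{2}}\in L^p(\mathbb S^n)$ and $e^{\frac{(n-2)f_{j_k}}{2}}\to e^{\frac{(n-2)f_\infty}{2}}$ strongly in $L^p(\mathbb S^n)$ as $k\to\infty$. -/

import Mathlib

open MeasureTheory Filter Topology
open scoped Manifold ContDiff ENNReal RealInnerProductSpace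

noncomputable section

namespace ConformalSphere

/-- The ambient Euclidean space `ℝⁿ⁺¹`. -/
abbrev Amb (n : ℕ) : Type := EuclideanSpace ℝ (Fin (n + 1))

/-- The unit sphere `𝕊ⁿ ⊂ ℝⁿ⁺¹`, with Mathlib's smooth structure (stereographic charts). -/
abbrev Sph (n : ℕ) : Type := Metric.sphere (0 : Amb n) 1

/-- The volume measure `dV` of the round metric: the surface measure on the unit sphere. -/
abbrev roundVolume (n : ℕ) : Measure (Sph n) := (volume : Measure (Amb n)).toSphere

/-! ### Metric tensors, scalar curvature and volume -/

/-- Fields of (bilinear) forms on the tangent spaces of the sphere. -/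
abbrev MetricField (n : ℕ) : Type :=
  ∀ x : Sph n, TangentSpace (𝓡 n) x → TangentSpace (𝓡 n) x → ℝ

/-- The differential at `x` of the inclusion `𝕊ⁿ → ℝⁿ⁺¹`, applied to a tangent vector. -/
def inclDeriv (n : ℕ) (x : Sph n) (v : TangentSpace (𝓡 n) x) : Amb n :=
  mfderiv (𝓡 n) 𝓘(ℝ, Amb n) (fun y : Sph n => (y : Amb n)) x v

/-- The round metric: the restriction of the Euclidean inner product to tangent vectors. -/
def roundMetric (n : ℕ) : MetricField n :=
  fun x v w => ⟪inclDeriv n x v, inclDeriv n x w⟫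

/-- The conformal metric `e^{2f} g_{𝕊ⁿ}`. -/
def conformalMetric (n : ℕ) (f : Sph n → ℝ) : MetricField n :=
  fun x v w => Real.exp (2 * f x) * roundMetric n x v w

/-- The `i`-th coordinate vector of `ℝⁿ`. -/
abbrev basisVec {n : ℕ} (i : Fin n) : EuclideanSpace ℝ (Fin n) := EuclideanSpace.single i 1

/-- The coordinate vector field `∂ᵢ` of the chart around `x`, at the point with coordinates `y`. -/
def coordVec {n : ℕ} (x : Sph n) (y : EuclideanSpace ℝ (Fin n)) (i : Fin n) :
    TangentSpace (𝓡 n) ((extChartAt (𝓡 n) x).symm y) :=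
  mfderiv 𝓘(ℝ, EuclideanSpace ℝ (Fin n)) (𝓡 n) (extChartAt (𝓡 n) x).symm y (basisVec i)

/-- The components `g_{ij} = g(∂ᵢ, ∂ⱼ)` in the chart around `x`, as functions of the coordinates. -/
def coordMetric {n : ℕ} (g : MetricField n) (x : Sph n) (y : EuclideanSpace ℝ (Fin n)) :
    Matrix (Fin n) (Fin n) ℝ :=
  Matrix.of fun i j => g ((extChartAt (𝓡 n) x).symm y) (coordVec x y i) (coordVec x y j)

/-- The partial derivative `∂F/∂yᵢ`. -/
def pd {n : ℕ} (i : Fin n) (F : EuclideanSpace ℝ (Fin n) → ℝ)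
    (y : EuclideanSpace ℝ (Fin n)) : ℝ :=
  fderiv ℝ F y (basisVec i)

/-- Christoffel symbols `Γᵏᵢⱼ = ½ ∑ₗ gᵏˡ (∂ᵢ gⱼₗ + ∂ⱼ gᵢₗ - ∂ₗ gᵢⱼ)` of a metric `G` given in
coordinates. -/
def christoffel {n : ℕ} (G : EuclideanSpace ℝ (Fin n) → Matrix (Fin n) (Fin n) ℝ)
    (k i j : Fin n) (y : EuclideanSpace ℝ (Fin n)) : ℝ :=
  (1 / 2) * ∑ l, (G y)⁻¹ k l *
    (pd i (fun z => G z j l) y + pd j (fun z => G z i l) y - pd l (fun z => G z i j) y)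

/-- Ricci curvature
`Rᵢⱼ = ∑ₖ (∂ₖ Γᵏᵢⱼ - ∂ⱼ Γᵏᵢₖ + ∑ₗ (Γᵏₖₗ Γˡᵢⱼ - Γᵏⱼₗ Γˡᵢₖ))` in coordinates. -/
def ricci {n : ℕ} (G : EuclideanSpace ℝ (Fin n) → Matrix (Fin n) (Fin n) ℝ)
    (i j : Fin n) (y : EuclideanSpace ℝ (Fin n)) : ℝ :=
  ∑ k, (pd k (christoffel G k i j) y - pd j (christoffel G k i k) y +
    ∑ l, (christoffel G k k l y * christoffel G l i j y -
      christoffel G k j l y * christoffel G l i k y))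

/-- The scalar curvature `Sc_g = ∑ᵢⱼ gⁱʲ Rᵢⱼ` at `x`, computed in the chart around `x`. -/
def scalarCurvature {n : ℕ} (g : MetricField n) (x : Sph n) : ℝ :=
  ∑ i, ∑ j, (coordMetric g x (extChartAt (𝓡 n) x x))⁻¹ i j *
    ricci (coordMetric g x) i j (extChartAt (𝓡 n) x x)

/-- The density `√(det g) / √(det g_{𝕊ⁿ})` of the Riemannian volume of `g` with respect to the
volume of the round metric (both determinants are taken in the same coordinates). -/
def volumeDensity {n : ℕ} (g : MetricField n) (x : Sph n) : ℝ :=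
  Real.sqrt (coordMetric g x (extChartAt (𝓡 n) x x)).det /
    Real.sqrt (coordMetric (roundMetric n) x (extChartAt (𝓡 n) x x)).det

/-- The Riemannian volume `Vol_g(𝕊ⁿ)`. -/
def totalVolume {n : ℕ} (g : MetricField n) : ℝ≥0∞ :=
  ∫⁻ x, ENNReal.ofReal (volumeDensity g x) ∂(roundVolume n)

/-! ### Gradient, divergence and Sobolev spaces for the round metric -/

/-- The gradient of `u : 𝕊ⁿ → ℝ` for the round metric, as a vector of `ℝⁿ⁺¹` tangent to the sphere:
the Euclidean gradient at `x` of the extension `z ↦ u (z / |z|)` of `u`, which is constant along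
rays.  (The value chosen for this extension at `z = 0` plays no role.) -/
def sphereGrad {n : ℕ} (u : Sph n → ℝ) (x : Sph n) : Amb n :=
  gradient (fun z : Amb n =>
    if hz : z = 0 then 0
    else u ⟨‖z‖⁻¹ • z, by simp [norm_smul, inv_mul_cancel₀ (norm_ne_zero_iff.mpr hz)]⟩) x

/-- The divergence along the unit sphere of a vector field that is tangent to it: the trace of `DY`
over the tangent space `xᗮ`. -/
def sphereDiv {n : ℕ} (Y : Amb n → Amb n) (x : Sph n) : ℝ :=
  LinearMap.trace ℝ (Amb n) (fderiv ℝ Y x).toLinearMap - ⟪fderiv ℝ Y x x, (x : Amb n)⟫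

/-- `Y` restricts to a smooth tangent vector field on the sphere. (Every smooth tangent vector field
on the sphere is such a restriction.) -/
def IsTestField {n : ℕ} (Y : Amb n → Amb n) : Prop :=
  ContDiff ℝ ∞ Y ∧ ∀ x : Sph n, ⟪Y x, (x : Amb n)⟫ = 0

/-- `X` is the weak gradient of `u` on the round sphere: `X` is tangent to the sphere and
`∫ ⟨X, Y⟩ dV = - ∫ u div Y dV` for all smooth tangent vector fields `Y`. -/
def IsWeakGrad {n : ℕ} (u : Sph n → ℝ) (X : Sph n → Amb n) : Prop :=
  (∀ᵐ x ∂(roundVolume n), ⟪X x, (x : Amb n)⟫ = 0) ∧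
  ∀ Y : Amb n → Amb n, IsTestField Y →
    ∫ x, ⟪X x, Y x⟫ ∂(roundVolume n) = - ∫ x, u x * sphereDiv Y x ∂(roundVolume n)

theorem continuous_sphereDiv {n : ℕ} {Y : Amb n → Amb n} (hY : IsTestField Y) :
    Continuous (sphereDiv Y) := by
  have h1 : Continuous (fderiv ℝ Y) := hY.1.continuous_fderiv (by simp)
  have h2 : Continuous fun x : Sph n => fderiv ℝ Y (x : Amb n) := h1.comp continuous_subtype_val
  have h3 : Continuous fun A : Amb n →L[ℝ] Amb n =>
      LinearMap.trace ℝ (Amb n) A.toLinearMap :=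
    LinearMap.continuous_of_finiteDimensional
      ((LinearMap.trace ℝ (Amb n)).comp (ContinuousLinearMap.coeLM ℝ))
  exact (h3.comp h2).sub ((h2.clm_apply continuous_subtype_val).inner continuous_subtype_val)

theorem integrable_mul_sphereDiv {n : ℕ} {u : Sph n → ℝ} (hu : Integrable u (roundVolume n))
    {Y : Amb n → Amb n} (hY : IsTestField Y) :
    Integrable (fun x => u x * sphereDiv Y x) (roundVolume n) := by
  obtain ⟨C, hC⟩ := isCompact_univ.exists_bound_of_continuousOn
    (continuous_sphereDiv hY).continuousOn
  exact hu.mul_bdd (continuous_sphereDiv hY).aestronglyMeasurable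
    (Eventually.of_forall fun x => hC x (Set.mem_univ x))

theorem integrable_inner_testField {n : ℕ} {X : Sph n → Amb n}
    (hX : Integrable X (roundVolume n)) {Y : Amb n → Amb n} (hY : IsTestField Y) :
    Integrable (fun x : Sph n => ⟪X x, Y x⟫) (roundVolume n) := by
  have hc : Continuous fun x : Sph n => Y x := hY.1.continuous.comp continuous_subtype_val
  obtain ⟨C, hC⟩ := isCompact_univ.exists_bound_of_continuousOn hc.continuousOn
  refine (hX.norm.mul_const C).mono'
    (hX.aestronglyMeasurable.inner hc.aestronglyMeasurable) (Eventually.of_forall fun x => ?_)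
  exact (norm_inner_le_norm _ _).trans
    (mul_le_mul_of_nonneg_left (hC x (Set.mem_univ x)) (norm_nonneg _))

theorem IsWeakGrad.congr {n : ℕ} {u u' : Sph n → ℝ} {X X' : Sph n → Amb n}
    (h : IsWeakGrad u X) (hu : u =ᵐ[roundVolume n] u') (hX : X =ᵐ[roundVolume n] X') :
    IsWeakGrad u' X' := by
  refine ⟨?_, fun Y hY => ?_⟩
  · filter_upwards [h.1, hX] with x h1 h2
    rw [← h2, h1]
  · rw [integral_congr_ae (g := fun x : Sph n => ⟪X x, Y x⟫),
      integral_congr_ae (f := fun x => u' x * sphereDiv Y x) (g := fun x => u x * sphereDiv Y x)]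
    · exact h.2 Y hY
    · filter_upwards [hu] with x h1
      rw [h1]
    · filter_upwards [hX] with x h1
      rw [h1]

theorem isWeakGrad_zero {n : ℕ} : IsWeakGrad (0 : Sph n → ℝ) (0 : Sph n → Amb n) := by
  refine ⟨Eventually.of_forall fun x => ?_, fun Y _ => ?_⟩ <;> simp

theorem IsWeakGrad.add {n : ℕ} {u u' : Sph n → ℝ} {X X' : Sph n → Amb n}
    (h : IsWeakGrad u X) (h' : IsWeakGrad u' X')
    (hu : Integrable u (roundVolume n)) (hu' : Integrable u' (roundVolume n))
    (hX : Integrable X (roundVolume n)) (hX' : Integrable X' (roundVolume n)) :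
    IsWeakGrad (u + u') (X + X') := by
  refine ⟨?_, fun Y hY => ?_⟩
  · filter_upwards [h.1, h'.1] with x h1 h2
    rw [Pi.add_apply, inner_add_left, h1, h2, add_zero]
  · simp only [Pi.add_apply, inner_add_left, add_mul]
    rw [integral_add (integrable_inner_testField hX hY) (integrable_inner_testField hX' hY),
      integral_add (integrable_mul_sphereDiv hu hY) (integrable_mul_sphereDiv hu' hY),
      h.2 Y hY, h'.2 Y hY]
    ring

theorem IsWeakGrad.smul {n : ℕ} {u : Sph n → ℝ} {X : Sph n → Amb n} (c : ℝ)
    (h : IsWeakGrad u X) : IsWeakGrad (c • u) (c • X) := by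
  refine ⟨?_, fun Y hY => ?_⟩
  · filter_upwards [h.1] with x h1
    rw [Pi.smul_apply, real_inner_smul_left, h1, mul_zero]
  · simp only [Pi.smul_apply, real_inner_smul_left, smul_eq_mul, mul_assoc]
    rw [integral_const_mul, integral_const_mul, h.2 Y hY]
    ring

/-- The Sobolev space `W^{1,q}(𝕊ⁿ)` of the round sphere, `1 ≤ q ≤ ∞`: the pairs `(u, ∇u)` of a
function `u ∈ L^q` and its weak gradient `∇u ∈ L^q` (which `u` determines), with the norm
`max (‖u‖_q, ‖∇u‖_q)`, equivalent to the other usual norms. -/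
def Sobolev (n : ℕ) (q : ℝ≥0∞) [Fact (1 ≤ q)] :
    Submodule ℝ (Lp ℝ q (roundVolume n) × Lp (Amb n) q (roundVolume n)) where
  carrier := {p | IsWeakGrad p.1 p.2}
  zero_mem' := isWeakGrad_zero.congr (Lp.coeFn_zero ℝ q (roundVolume n)).symm
    (Lp.coeFn_zero (Amb n) q (roundVolume n)).symm
  add_mem' := by
    intro a b ha hb
    have hq : (1 : ℝ≥0∞) ≤ q := Fact.out
    exact (IsWeakGrad.add ha hb ((Lp.memLp a.1).integrable hq) ((Lp.memLp b.1).integrable hq)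
      ((Lp.memLp a.2).integrable hq) ((Lp.memLp b.2).integrable hq)).congr
      (Lp.coeFn_add a.1 b.1).symm (Lp.coeFn_add a.2 b.2).symm
  smul_mem' := by
    intro c a ha
    exact (IsWeakGrad.smul c ha).congr (Lp.coeFn_smul c a.1).symm (Lp.coeFn_smul c a.2).symm

/-- `u_j ⇀ v` weakly in `W^{1,q}(𝕊ⁿ)`: all `u_j` and `v` represent elements of `W^{1,q}`, and these
converge in the weak topology of that space. -/
def TendstoWeaklySobolev (n : ℕ) (q : ℝ≥0∞) [Fact (1 ≤ q)]
    (u : ℕ → Sph n → ℝ) (v : Sph n → ℝ) : Prop :=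
  ∃ (w : ℕ → Sobolev n q) (w' : Sobolev n q),
    (∀ j, (w j).1.1 =ᵐ[roundVolume n] u j) ∧ w'.1.1 =ᵐ[roundVolume n] v ∧
    Tendsto (fun j => toWeakSpace ℝ (Sobolev n q) (w j)) atTop
      (𝓝 (toWeakSpace ℝ (Sobolev n q) w'))

/-- `u_j → v` strongly in `L^p(𝕊ⁿ)`. -/
def TendstoLp (n : ℕ) (p : ℝ≥0∞) (u : ℕ → Sph n → ℝ) (v : Sph n → ℝ) : Prop :=
  (∀ j, MemLp (u j) p (roundVolume n)) ∧ MemLp v p (roundVolume n) ∧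
    Tendsto (fun j => eLpNorm (u j - v) p (roundVolume n)) atTop (𝓝 0)

/-- The power `e^{(n-2)f/2}` of the conformal factor. -/
def factor (n : ℕ) (f : Sph n → ℝ) (x : Sph n) : ℝ :=
  Real.exp (((n : ℝ) - 2) / 2 * f x)

/-- The function `e^{(n-2)f/2}` for `f` with values in `[-∞, ∞)`, where `e^{-∞} = 0`. -/
def factorExt (n : ℕ) (f : Sph n → EReal) (x : Sph n) : ℝ :=
  (EReal.exp ((((n : ℝ) - 2) / 2 : ℝ) * f x)).toReal

end ConformalSphere

end

open ConformalSphere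

/-!
Let `f` be smooth on the round sphere and put `u = e^{(n-2)f/2}`. For the metric `e^{2f} g_{𝕊ⁿ}`,
nonnegative scalar curvature is the differential inequality `2 Δf + (n - 2) |∇f|² ≤ n`
(`sphereDiv_gradient_le`), and the volume is `∫ e^{nf}` (`totalVolume_conformalMetric`), so that the
volume bound controls `∫ e^{βf}` for all `0 ≤ β ≤ n`. Multiplying the inequality by `e^{βf}` and
integrating by parts gives
`(n - 2 - 2β) ∫ e^{βf} |∇f|² ≤ n ∫ e^{βf}`
(`mul_integral_exp_mul_norm_sphereGrad_sq_le`), so `e^{βf/2} ∇f` is bounded in `L²` for every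
`0 ≤ β < (n - 2) / 2`. Since `∇u` is `(n - 2) / 2` times the product of `e^{(n-2-β)f/2}` and
`e^{βf/2} ∇f`, Young's inequality bounds `∫ |∇u|^q`, as long as the power of `e^f` that is left over
has exponent at most `n`. Letting `β` approach `(n - 2) / 2`, this covers all `q < 4n / (3n - 2)`
(`exists_integral_norm_sphereGrad_factor_rpow_le`).

For a sequence, the bounds of `u_j` in `L²` and of `∇u_j` in `L¹` give almost everywhere convergence
along a subsequence, by a Rellich theorem proved with mollifiers in `ℝⁿ⁺¹` and applied to
`η(|z|) u_j(z / |z|)` for a bump function `η` (`exists_subseq_tendsto_ae`). By Vitali's theorem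
every power `e^{γf_j}` then converges strongly in `L^p` for `p < n / γ`
(`tendsto_eLpNorm_exp_mul`), which is the strong convergence of `u_j` for `γ = (n - 2) / 2`. Passing
to a further subsequence, `e^{βf_j/2} ∇f_j` converges weakly in `L²` for countably many `β` tending
to `(n - 2) / 2`. The product of a strongly and a weakly convergent sequence being weakly
convergent, `∇u_j` converges weakly in `L^q` (`tendstoWeaklySobolev_factor`); no appeal to
reflexivity is made, and the case `q = 1` needs no separate argument. The limit is the weak gradient
of the limit of `u_j`, because the defining identity passes to weak limits
(`isWeakGrad_of_tendsto`).

The divergence theorem and integration by parts on the sphere are derived from those in `ℝⁿ⁺¹` by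
polar coordinates, a function on the sphere being extended to be constant along rays
(`radialExt`). The scalar curvature is computed in stereographic coordinates, in which
`e^{2f} g_{𝕊ⁿ}` is conformal to the flat metric (`coordMetric_conformalMetric`).
-/

noncomputable section

namespace ConformalSphere

/-! ### Radial extensions -/

/-- The extension of `u : 𝕊ⁿ → ℝ` to `ℝⁿ⁺¹` that is constant along rays (and `0` at the origin). -/
def radialExt {n : ℕ} (u : Sph n → ℝ) (z : Amb n) : ℝ :=
  if hz : z = 0 then 0
  else u ⟨‖z‖⁻¹ • z, by simp [norm_smul, inv_mul_cancel₀ (norm_ne_zero_iff.mpr hz)]⟩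

theorem sphereGrad_eq_gradient {n : ℕ} (u : Sph n → ℝ) (x : Sph n) :
    sphereGrad u x = gradient (radialExt u) (x : Amb n) := rfl

theorem norm_coe_sph {n : ℕ} (x : Sph n) : ‖(x : Amb n)‖ = 1 := norm_eq_of_mem_sphere x

theorem coe_sph_ne_zero {n : ℕ} (x : Sph n) : (x : Amb n) ≠ 0 := by
  intro h
  simpa [h] using norm_coe_sph x

theorem ae_ne_zero_amb {n : ℕ} : ∀ᵐ z : Amb n, z ≠ 0 := by simp [ae_iff]

theorem radialExt_of_ne {n : ℕ} (u : Sph n → ℝ) {z : Amb n} (hz : z ≠ 0) :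
    radialExt u z =
      u ⟨‖z‖⁻¹ • z, by simp [norm_smul, inv_mul_cancel₀ (norm_ne_zero_iff.mpr hz)]⟩ :=
  dif_neg hz

@[simp]
theorem radialExt_coe {n : ℕ} (u : Sph n → ℝ) (x : Sph n) : radialExt u (x : Amb n) = u x := by
  rw [radialExt_of_ne u (coe_sph_ne_zero x)]
  congr 1
  ext1
  simp [norm_coe_sph x]

theorem radialExt_pos_smul {n : ℕ} (u : Sph n → ℝ) {c : ℝ} (hc : 0 < c) (z : Amb n) :
    radialExt u (c • z) = radialExt u z := by
  by_cases hz : z = 0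
  · simp [hz]
  · rw [radialExt_of_ne u hz, radialExt_of_ne u (smul_ne_zero hc.ne' hz)]
    congr 2
    rw [norm_smul, smul_smul, Real.norm_of_nonneg hc.le]
    congr 1
    field_simp

theorem radialExt_comp {n : ℕ} (u : Sph n → ℝ) (g : ℝ → ℝ) {z : Amb n} (hz : z ≠ 0) :
    radialExt (fun x => g (u x)) z = g (radialExt u z) := by
  rw [radialExt_of_ne _ hz, radialExt_of_ne _ hz]

theorem radialExt_comp_eventuallyEq {n : ℕ} (u : Sph n → ℝ) (g : ℝ → ℝ) {z : Amb n} (hz : z ≠ 0) :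
    radialExt (fun x => g (u x)) =ᶠ[𝓝 z] fun z => g (radialExt u z) := by
  filter_upwards [isOpen_ne.mem_nhds hz] with w hw
  exact radialExt_comp u g hw

theorem contDiffAt_radialExt {n : ℕ} {f : Sph n → ℝ} (hf : ContMDiff (𝓡 n) 𝓘(ℝ, ℝ) ∞ f)
    {z : Amb n} (hz : z ≠ 0) : ContDiffAt ℝ ∞ (radialExt f) z := by
  have := Fact.mk (@finrank_euclideanSpace_fin ℝ _ (n + 1))
  let U : TopologicalSpace.Opens (Amb n) := ⟨{0}ᶜ, isOpen_compl_singleton⟩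
  have h1 : ∀ w : U, ‖(w : Amb n)‖⁻¹ • (w : Amb n) ∈ Metric.sphere (0 : Amb n) 1 := fun w => by
    have : (w : Amb n) ≠ 0 := w.2
    simp [norm_smul, inv_mul_cancel₀ (norm_ne_zero_iff.mpr this)]
  have h2 : ContMDiff 𝓘(ℝ, Amb n) 𝓘(ℝ, Amb n) ∞
      (fun w : U => ‖(w : Amb n)‖⁻¹ • (w : Amb n)) := by
    intro w
    refine (contMDiffAt_subtype_iff (f := fun w : Amb n => ‖w‖⁻¹ • w) (x := w)).2 ?_
    refine ContDiffAt.contMDiffAt ?_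
    have hw : (w : Amb n) ≠ 0 := w.2
    exact ((contDiffAt_norm ℝ hw).inv (norm_ne_zero_iff.2 hw)).smul contDiffAt_id
  have h3 : ContMDiff 𝓘(ℝ, Amb n) 𝓘(ℝ, ℝ) ∞ (fun w : U => radialExt f w) := by
    have := hf.comp (h2.codRestrict_sphere h1)
    refine this.congr fun w => ?_
    exact radialExt_of_ne f w.2
  exact ((contMDiffAt_subtype_iff (f := radialExt f) (x := (⟨z, hz⟩ : U))).1 (h3 _)).contDiffAt

theorem contDiffAt_gradient {n : ℕ} {F : Amb n → ℝ} {z : Amb n} (h : ContDiffAt ℝ ∞ F z) :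
    ContDiffAt ℝ ∞ (gradient F) z := by
  have h1 : ContDiffAt ℝ ∞ (fderiv ℝ F) z := h.fderiv_right (m := ∞) (by simp)
  exact (InnerProductSpace.toDual ℝ (Amb n)).symm.contDiff.contDiffAt.comp z h1

theorem contDiffAt_gradient_radialExt {n : ℕ} {f : Sph n → ℝ}
    (hf : ContMDiff (𝓡 n) 𝓘(ℝ, ℝ) ∞ f) {z : Amb n} (hz : z ≠ 0) :
    ContDiffAt ℝ ∞ (gradient (radialExt f)) z :=
  contDiffAt_gradient (contDiffAt_radialExt hf hz)

theorem continuous_sphereGrad {n : ℕ} {f : Sph n → ℝ} (hf : ContMDiff (𝓡 n) 𝓘(ℝ, ℝ) ∞ f) :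
    Continuous (sphereGrad f) := by
  refine continuous_iff_continuousAt.2 fun x => ?_
  exact ContinuousAt.comp (f := fun x : Sph n => (x : Amb n))
    (contDiffAt_gradient_radialExt hf (coe_sph_ne_zero x)).continuousAt
    continuous_subtype_val.continuousAt

/-- The radial extension is constant along rays, so its radial derivative vanishes. -/
theorem fderiv_radialExt_self {n : ℕ} {f : Sph n → ℝ} (hf : ContMDiff (𝓡 n) 𝓘(ℝ, ℝ) ∞ f)
    {z : Amb n} (hz : z ≠ 0) : fderiv ℝ (radialExt f) z z = 0 := by
  have h1 : HasDerivAt (fun t : ℝ => radialExt f (t • z)) (fderiv ℝ (radialExt f) z z) 1 := by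
    have hF : HasFDerivAt (radialExt f) (fderiv ℝ (radialExt f) z) ((1 : ℝ) • z) := by
      rw [one_smul]
      exact ((contDiffAt_radialExt hf hz).differentiableAt (by simp)).hasFDerivAt
    have hg : HasDerivAt (fun t : ℝ => t • z) z 1 := by
      simpa using (hasDerivAt_id (1 : ℝ)).smul_const z
    exact hF.comp_hasDerivAt 1 hg
  have h2 : HasDerivAt (fun t : ℝ => radialExt f (t • z)) 0 1 := by
    refine (hasDerivAt_const (1 : ℝ) (radialExt f z)).congr_of_eventuallyEq ?_
    filter_upwards [lt_mem_nhds (zero_lt_one' ℝ)] with t ht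
    exact radialExt_pos_smul f ht z
  exact h1.unique h2

theorem inner_gradient_radialExt_self {n : ℕ} {f : Sph n → ℝ}
    (hf : ContMDiff (𝓡 n) 𝓘(ℝ, ℝ) ∞ f) {z : Amb n} (hz : z ≠ 0) :
    ⟪gradient (radialExt f) z, z⟫ = 0 := by
  have h := HasGradientAt.fderiv_apply (y := z)
    ((contDiffAt_radialExt hf hz).differentiableAt (by simp)).hasGradientAt
  rw [← h, fderiv_radialExt_self hf hz]

theorem inner_sphereGrad_self {n : ℕ} {f : Sph n → ℝ} (hf : ContMDiff (𝓡 n) 𝓘(ℝ, ℝ) ∞ f)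
    (x : Sph n) : ⟪sphereGrad f x, (x : Amb n)⟫ = 0 :=
  inner_gradient_radialExt_self hf (coe_sph_ne_zero x)

/-! ### Polar coordinates and the divergence theorem -/

/-- Integration in polar coordinates of a product of a radial function and a function constant
along rays. -/
theorem integral_radial_mul_radialExt {n : ℕ} (g : ℝ → ℝ) (u : Sph n → ℝ) :
    ∫ z : Amb n, radialExt u z * g ‖z‖ =
      (∫ x, u x ∂(roundVolume n)) * ∫ r : Set.Ioi (0 : ℝ), g r ∂(Measure.volumeIoiPow n) := by
  have hd : Module.finrank ℝ (Amb n) - 1 = n := by simp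
  have key := (volume : Measure (Amb n)).measurePreserving_homeomorphUnitSphereProd.integral_comp
    (Homeomorph.measurableEmbedding _) (fun p : Sph n × Set.Ioi (0 : ℝ) => u p.1 * g p.2)
  rw [integral_prod_mul u (fun r : Set.Ioi (0 : ℝ) => g r), hd] at key
  have h1 : ∫ z : Amb n, radialExt u z * g ‖z‖ =
      ∫ z : ({0}ᶜ : Set (Amb n)), radialExt u z * g ‖(z : Amb n)‖
        ∂((volume : Measure (Amb n)).comap Subtype.val) := by
    rw [integral_subtype_comap (measurableSet_singleton _).compl
      (fun z : Amb n => radialExt u z * g ‖z‖), restrict_compl_singleton]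
  rw [h1, ← key]
  congr 1
  funext z
  simp only [homeomorphUnitSphereProd_apply_snd_coe]
  rw [radialExt_of_ne u z.2]
  congr 2
  ext1
  simp

/-- A smooth bump function on the line, supported in `[1, 3]`. -/
def radialBump : ContDiffBump (2 : ℝ) := ⟨1 / 2, 1, by norm_num, by norm_num⟩

theorem radialBump_eq_zero_of_lt {r : ℝ} (h : r < 1) : radialBump r = 0 :=
  radialBump.zero_of_le_dist (by
    rw [Real.dist_eq, abs_of_neg (by linarith)]; simp only [radialBump]; linarith)

theorem radialBump_eq_zero_of_gt {r : ℝ} (h : 3 < r) : radialBump r = 0 :=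
  radialBump.zero_of_le_dist (by
    rw [Real.dist_eq, abs_of_pos (by linarith)]; simp only [radialBump]; linarith)

/-- Multiplying a map that is `C¹` off the origin by a radial bump function makes it `C¹`. -/
theorem contDiff_radialBump_smul {n : ℕ} {G : Type*} [NormedAddCommGroup G] [NormedSpace ℝ G]
    {F : Amb n → G} (hF : ∀ z, z ≠ 0 → ContDiffAt ℝ 1 F z) :
    ContDiff ℝ 1 (fun z : Amb n => radialBump ‖z‖ • F z) := by
  refine contDiff_iff_contDiffAt.2 fun z => ?_
  by_cases hz : z = 0
  · refine (contDiffAt_const (c := (0 : G))).congr_of_eventuallyEq ?_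
    have : ∀ᶠ w : Amb n in 𝓝 z, ‖w‖ < 1 := by
      refine continuous_norm.continuousAt.eventually_lt continuousAt_const ?_
      simp [hz]
    filter_upwards [this] with w hw
    simp [radialBump_eq_zero_of_lt hw]
  · exact ((radialBump.contDiff.contDiffAt).comp z (contDiffAt_norm ℝ hz)).smul (hF z hz)

theorem radialBump_smul_eq_zero {n : ℕ} {G : Type*} [NormedAddCommGroup G] [NormedSpace ℝ G]
    (F : Amb n → G) {z : Amb n} (hz : z ∉ Metric.closedBall (0 : Amb n) 3) :
    radialBump ‖z‖ • F z = 0 := by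
  have : 3 < ‖z‖ := by simpa using hz
  rw [radialBump_eq_zero_of_gt this, zero_smul]

theorem hasCompactSupport_radialBump_smul {n : ℕ} {G : Type*} [NormedAddCommGroup G]
    [NormedSpace ℝ G] (F : Amb n → G) :
    HasCompactSupport (fun z : Amb n => radialBump ‖z‖ • F z) :=
  HasCompactSupport.intro (isCompact_closedBall (0 : Amb n) 3)
    fun _ hz => radialBump_smul_eq_zero F hz

theorem integral_fderiv_apply_eq_zero {n : ℕ} {Z : Amb n → ℝ} (hZ : ContDiff ℝ 1 Z)
    (hc : HasCompactSupport Z) (v : Amb n) : ∫ z, fderiv ℝ Z z v = 0 := by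
  have h1 : Integrable (fun z => fderiv ℝ Z z v) := by
    refine Continuous.integrable_of_hasCompactSupport ?_ (hc.fderiv_apply ℝ v)
    exact (hZ.continuous_fderiv (by simp)).clm_apply continuous_const
  have := integral_mul_fderiv_eq_neg_fderiv_mul_of_integrable (μ := (volume : Measure (Amb n)))
    (f := fun _ => (1 : ℝ)) (g := Z) (v := v) (by simp)
    (by simpa using h1) (by simpa using hZ.continuous.integrable_of_hasCompactSupport hc)
    (fun _ _ => differentiableAt_const _) (fun z _ => hZ.differentiable (by simp) z)
  simpa using this

/-- The divergence theorem for compactly supported vector fields. -/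
theorem integral_trace_fderiv_eq_zero {n : ℕ} {Z : Amb n → Amb n} (hZ : ContDiff ℝ 1 Z)
    (hc : HasCompactSupport Z) :
    ∫ z, LinearMap.trace ℝ (Amb n) (fderiv ℝ Z z).toLinearMap = 0 := by
  let b := EuclideanSpace.basisFun (Fin (n + 1)) ℝ
  have h0 : ∀ z, LinearMap.trace ℝ (Amb n) (fderiv ℝ Z z).toLinearMap =
      ∑ i, fderiv ℝ (fun w => ⟪b i, Z w⟫) z (b i) := by
    intro z
    rw [LinearMap.trace_eq_sum_inner _ b]
    refine Finset.sum_congr rfl fun i _ => ?_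
    have : HasFDerivAt (fun w => ⟪b i, Z w⟫) ((innerSL ℝ (b i)).comp (fderiv ℝ Z z)) z :=
      (innerSL ℝ (b i)).hasFDerivAt.comp z (hZ.differentiable (by simp) z).hasFDerivAt
    rw [this.fderiv]
    rfl
  have hs : ∀ i, ContDiff ℝ 1 (fun w => ⟪b i, Z w⟫) := fun i => contDiff_const.inner ℝ hZ
  have hsc : ∀ i, HasCompactSupport (fun w => ⟪b i, Z w⟫) := fun i =>
    hc.comp_left (g := fun w => ⟪b i, w⟫) (by simp)
  simp_rw [h0]
  rw [integral_finsetSum]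
  · exact Finset.sum_eq_zero fun i _ => integral_fderiv_apply_eq_zero (hs i) (hsc i) _
  · intro i _
    refine Continuous.integrable_of_hasCompactSupport ?_ ((hsc i).fderiv_apply ℝ _)
    exact ((hs i).continuous_fderiv (by simp)).clm_apply continuous_const

/-- The radial factor in polar coordinates is positive: up to the area of the sphere it is the
integral of `g(|z|)` over `ℝⁿ⁺¹`. -/
theorem integral_volumeIoiPow_pos {n : ℕ} {g : ℝ → ℝ} (hg : Continuous g) (h0 : ∀ r, 0 ≤ g r)
    (h2 : g 2 ≠ 0) (hc : ∀ r, 3 < r → g r = 0) :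
    0 < ∫ r : Set.Ioi (0 : ℝ), g r ∂(Measure.volumeIoiPow n) := by
  have hpos : 0 < ∫ z : Amb n, radialExt (fun _ => (1 : ℝ)) z * g ‖z‖ := by
    have h1 : 0 < ∫ z : Amb n, g ‖z‖ := by
      refine Continuous.integral_pos_of_hasCompactSupport_nonneg_nonzero
        (x := (2 : ℝ) • (EuclideanSpace.single 0 1 : Amb n)) (hg.comp continuous_norm)
        ?_ (fun z => h0 _) ?_
      · refine HasCompactSupport.intro (isCompact_closedBall (0 : Amb n) 3) fun z hz => hc _ ?_
        simpa using hz
      · simpa [norm_smul] using h2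
    refine h1.trans_eq (integral_congr_ae ?_)
    filter_upwards [ae_ne_zero_amb] with z hz
    rw [radialExt_of_ne _ hz, one_mul]
  rw [integral_radial_mul_radialExt] at hpos
  by_contra hcon
  have h3 : (0 : ℝ) ≤ ∫ _ : Sph n, (1 : ℝ) ∂(roundVolume n) := integral_nonneg fun _ => zero_le_one
  have := mul_nonpos_of_nonneg_of_nonpos h3 (not_lt.1 hcon)
  linarith

theorem hasFDerivAt_norm_amb {n : ℕ} {z : Amb n} (hz : z ≠ 0) :
    HasFDerivAt (fun w : Amb n => ‖w‖) (‖z‖⁻¹ • innerSL ℝ z) z := by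
  have h1 := (hasStrictFDerivAt_norm_sq z).hasFDerivAt
  have hne : ‖z‖ ^ 2 ≠ 0 := by simpa using hz
  have h2 := h1.sqrt hne
  refine (h2.congr_of_eventuallyEq (Eventually.of_forall fun w => ?_)).congr_fderiv ?_
  · simp
  · ext w
    simp
    field_simp

theorem hasFDerivAt_norm_inv_smul {n : ℕ} {z : Amb n} (hz : z ≠ 0) :
    HasFDerivAt (fun w : Amb n => ‖w‖⁻¹ • w)
      (‖z‖⁻¹ • (ContinuousLinearMap.id ℝ (Amb n) -
        (innerSL ℝ (‖z‖⁻¹ • z)).smulRight (‖z‖⁻¹ • z))) z := by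
  have hne : ‖z‖ ≠ 0 := norm_ne_zero_iff.2 hz
  have h1 := ((hasDerivAt_inv hne).comp_hasFDerivAt z (hasFDerivAt_norm_amb hz)).smul
    (hasFDerivAt_id z)
  refine h1.congr_fderiv ?_
  ext1 w
  simp only [add_apply, smul_apply, sub_apply, ContinuousLinearMap.smulRight_apply,
    innerSL_apply_apply, id, ContinuousLinearMap.id_apply, smul_sub, smul_smul,
    real_inner_smul_left, smul_eq_mul]
  rw [sub_eq_add_neg, ← neg_smul]
  congr 2
  field_simp

/-- For a unit vector `x`, the trace of `T ∘ (id - x ⟨x, ·⟩)` is the trace of `T` over `xᗮ`, and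
adding the rank one map `y ⟨x, ·⟩` with `y ⟂ x` does not change it. -/
theorem trace_tangential_add_smulRight {n : ℕ} (T : Amb n →L[ℝ] Amb n) {x y : Amb n} (a b c : ℝ)
    (h : ⟪y, x⟫ = 0) :
    LinearMap.trace ℝ (Amb n) (a • T.comp (c • (ContinuousLinearMap.id ℝ (Amb n) -
        (innerSL ℝ x).smulRight x)) + (b • innerSL ℝ x).smulRight y :
          Amb n →L[ℝ] Amb n).toLinearMap =
      (LinearMap.trace ℝ (Amb n) T.toLinearMap - ⟪T x, x⟫) * (a * c) := by
  have e : (a • T.comp (c • (ContinuousLinearMap.id ℝ (Amb n) -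
        (innerSL ℝ x).smulRight x)) + (b • innerSL ℝ x).smulRight y :
          Amb n →L[ℝ] Amb n).toLinearMap =
      (a * c) • (T.toLinearMap - (innerSL ℝ x).toLinearMap.smulRight (T x)) +
      b • (innerSL ℝ x).toLinearMap.smulRight y := by
    ext1 w
    simp [smul_smul, smul_sub]
  have h' : ⟪x, y⟫ = 0 := by rw [real_inner_comm, h]
  rw [e, map_add, map_smul, map_sub, map_smul, LinearMap.trace_smulRight,
    LinearMap.trace_smulRight, real_inner_comm x (T x)]
  simp [h', mul_comm]

/-- The divergence of `η(|z|) Y(z/|z|)` for a field `Y` that is tangent to the unit sphere. -/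
theorem trace_fderiv_radialBump_smul {n : ℕ} {Y : Amb n → Amb n}
    (hY : ∀ z, z ≠ 0 → ContDiffAt ℝ 1 Y z) (ht : ∀ x : Sph n, ⟪Y x, (x : Amb n)⟫ = 0)
    {z : Amb n} (hz : z ≠ 0) :
    LinearMap.trace ℝ (Amb n)
      (fderiv ℝ (fun w : Amb n => radialBump ‖w‖ • Y (‖w‖⁻¹ • w)) z).toLinearMap =
      radialExt (sphereDiv Y) z * (radialBump ‖z‖ * ‖z‖⁻¹) := by
  have hz1 : ‖‖z‖⁻¹ • z‖ = 1 := by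
    simp [norm_smul, inv_mul_cancel₀ (norm_ne_zero_iff.mpr hz)]
  let x : Sph n := ⟨‖z‖⁻¹ • z, by simpa using hz1⟩
  have hYx := ((hY x (coe_sph_ne_zero x)).differentiableAt (by simp)).hasFDerivAt
  have h1 : HasFDerivAt (fun w : Amb n => Y (‖w‖⁻¹ • w)) _ z :=
    HasFDerivAt.comp z (f := fun w : Amb n => ‖w‖⁻¹ • w) hYx (hasFDerivAt_norm_inv_smul hz)
  have h2 : HasFDerivAt (fun w : Amb n => radialBump ‖w‖)
      (deriv radialBump ‖z‖ • innerSL ℝ (‖z‖⁻¹ • z)) z := by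
    rw [map_smul]
    exact ((radialBump.contDiff (n := 1)).differentiable (by simp)
      ‖z‖).hasDerivAt.comp_hasFDerivAt z (hasFDerivAt_norm_amb hz)
  have hx : radialExt (sphereDiv Y) z = sphereDiv Y x := radialExt_of_ne _ hz
  rw [(h2.fun_smul h1).fderiv, hx, sphereDiv]
  exact trace_tangential_add_smulRight _ _ _ _ (ht x)

/-- The divergence theorem on the sphere, for the restriction of a vector field that is `C¹` off
the origin and tangent to the sphere. -/
theorem integral_sphereDiv_eq_zero {n : ℕ} {Y : Amb n → Amb n}
    (hY : ∀ z, z ≠ 0 → ContDiffAt ℝ 1 Y z) (ht : ∀ x : Sph n, ⟪Y x, (x : Amb n)⟫ = 0) :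
    ∫ x, sphereDiv Y x ∂(roundVolume n) = 0 := by
  have hs : ∀ z : Amb n, z ≠ 0 → ContDiffAt ℝ 1 (fun w : Amb n => Y (‖w‖⁻¹ • w)) z := by
    intro z hz
    refine ContDiffAt.comp z (f := fun w : Amb n => ‖w‖⁻¹ • w) (hY _ ?_) ?_
    · simpa using hz
    · exact ((contDiffAt_norm ℝ hz).inv (norm_ne_zero_iff.2 hz)).smul contDiffAt_id
  have h1 := integral_trace_fderiv_eq_zero (contDiff_radialBump_smul hs)
    (hasCompactSupport_radialBump_smul _)
  have h3 : ∫ z : Amb n, radialExt (fun x : Sph n => sphereDiv Y x) z *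
      (radialBump ‖z‖ * ‖z‖⁻¹) = 0 := by
    rw [← h1]
    refine integral_congr_ae ?_
    filter_upwards [ae_ne_zero_amb] with z hz
    exact (trace_fderiv_radialBump_smul hY ht hz).symm
  rw [integral_radial_mul_radialExt (fun r => radialBump r * r⁻¹)] at h3
  refine (mul_eq_zero.1 h3).resolve_right ?_
  -- On the support of the bump function `r⁻¹` agrees with `(max r 1)⁻¹`, which is continuous.
  have hpos : 0 < ∫ r : Set.Ioi (0 : ℝ), (radialBump r * (max (r : ℝ) 1)⁻¹)
      ∂(Measure.volumeIoiPow n) := by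
    refine integral_volumeIoiPow_pos (g := fun r => radialBump r * (max r 1)⁻¹) ?_ ?_ ?_ ?_
    · refine radialBump.continuous.mul ((continuous_id.max continuous_const).inv₀ fun r => ?_)
      have : (1 : ℝ) ≤ max r 1 := le_max_right _ _
      simp only [id]
      linarith
    · intro r
      exact mul_nonneg radialBump.nonneg (inv_nonneg.2 (zero_le_one.trans (le_max_right _ _)))
    · have : radialBump 2 = 1 := radialBump.one_of_mem_closedBall (by simp [radialBump])
      simp [this]
    · intro r hr
      rw [radialBump_eq_zero_of_gt hr, zero_mul]
  refine ne_of_gt (hpos.trans_eq (integral_congr_ae (Eventually.of_forall fun r => ?_)))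
  rcases lt_or_ge (r : ℝ) 1 with h | h
  · simp [radialBump_eq_zero_of_lt h]
  · simp [max_eq_left h]

/-! ### Scalar curvature of a conformally flat metric -/

theorem pd_const {n : ℕ} (i : Fin n) (c : ℝ) (y : EuclideanSpace ℝ (Fin n)) :
    pd i (fun _ => c) y = 0 := by
  simp [pd]

theorem pd_exp_two_mul {n : ℕ} (i : Fin n) {h : EuclideanSpace ℝ (Fin n) → ℝ}
    {y : EuclideanSpace ℝ (Fin n)} (hh : DifferentiableAt ℝ h y) :
    pd i (fun z => Real.exp (2 * h z)) y = 2 * Real.exp (2 * h y) * pd i h y := by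
  have := (hh.hasFDerivAt.const_mul 2).exp
  simp only [pd, this.fderiv]
  simp
  ring

theorem contDiff_pd {n : ℕ} (i : Fin n) {h : EuclideanSpace ℝ (Fin n) → ℝ}
    (hh : ContDiff ℝ ∞ h) : ContDiff ℝ ∞ (pd i h) :=
  (hh.fderiv_right (m := ∞) (by simp)).clm_apply contDiff_const

/-- The metric `e^{2h} δ` on `ℝⁿ`. -/
def flatConformal {n : ℕ} (h : EuclideanSpace ℝ (Fin n) → ℝ) (y : EuclideanSpace ℝ (Fin n)) :
    Matrix (Fin n) (Fin n) ℝ :=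
  Matrix.of fun i j => if i = j then Real.exp (2 * h y) else 0

theorem flatConformal_eq_smul_one {n : ℕ} (h : EuclideanSpace ℝ (Fin n) → ℝ)
    (y : EuclideanSpace ℝ (Fin n)) :
    flatConformal h y = Real.exp (2 * h y) • (1 : Matrix (Fin n) (Fin n) ℝ) := by
  ext i j
  simp [flatConformal, Matrix.one_apply]

theorem flatConformal_inv {n : ℕ} (h : EuclideanSpace ℝ (Fin n) → ℝ)
    (y : EuclideanSpace ℝ (Fin n)) (i j : Fin n) :
    (flatConformal h y)⁻¹ i j = if i = j then Real.exp (-(2 * h y)) else 0 := by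
  have : (flatConformal h y)⁻¹ = Real.exp (-(2 * h y)) • (1 : Matrix (Fin n) (Fin n) ℝ) := by
    refine Matrix.inv_eq_right_inv ?_
    rw [flatConformal_eq_smul_one, Matrix.smul_mul, Matrix.one_mul, smul_smul, ← Real.exp_add]
    simp
  rw [this]
  simp [Matrix.one_apply]

theorem pd_flatConformal {n : ℕ} {h : EuclideanSpace ℝ (Fin n) → ℝ}
    {y : EuclideanSpace ℝ (Fin n)} (hh : DifferentiableAt ℝ h y) (i j k : Fin n) :
    pd i (fun z => flatConformal h z j k) y =
      if j = k then 2 * Real.exp (2 * h y) * pd i h y else 0 := by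
  by_cases hjk : j = k
  · simp only [flatConformal, hjk, Matrix.of_apply, if_true]
    exact pd_exp_two_mul i hh
  · simp only [flatConformal, hjk, Matrix.of_apply, if_false]
    exact pd_const _ _ _

theorem christoffel_flatConformal {n : ℕ} {h : EuclideanSpace ℝ (Fin n) → ℝ}
    (hh : Differentiable ℝ h) (k i j : Fin n) :
    christoffel (flatConformal h) k i j = fun y =>
      (if k = j then 1 else 0) * pd i h y + (if k = i then 1 else 0) * pd j h y -
        (if i = j then 1 else 0) * pd k h y := by
  funext y
  simp only [christoffel, flatConformal_inv, pd_flatConformal (hh y)]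
  rw [Finset.sum_eq_single k (fun l _ hl => by simp [Ne.symm hl]) (by simp)]
  have e : Real.exp (-(2 * h y)) * Real.exp (2 * h y) = 1 := by rw [← Real.exp_add]; simp
  simp only [if_true, eq_comm (a := j) (b := k), eq_comm (a := i) (b := k)]
  have e' : ∀ (P : Prop) [Decidable P] (t : ℝ),
      (if P then 2 * Real.exp (2 * h y) * t else 0) =
        2 * Real.exp (2 * h y) * ((if P then 1 else 0) * t) := fun P _ t => by
    split_ifs <;> simp
  rw [e', e', e']
  linear_combination ((if k = j then 1 else 0) * pd i h y + (if k = i then 1 else 0) * pd j h y -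
    (if i = j then 1 else 0) * pd k h y) * e

theorem pd_christoffel_flatConformal {n : ℕ} {h : EuclideanSpace ℝ (Fin n) → ℝ}
    (hh : ContDiff ℝ ∞ h) (m k i j : Fin n) (y : EuclideanSpace ℝ (Fin n)) :
    pd m (christoffel (flatConformal h) k i j) y =
      (if k = j then 1 else 0) * pd m (pd i h) y + (if k = i then 1 else 0) * pd m (pd j h) y -
        (if i = j then 1 else 0) * pd m (pd k h) y := by
  rw [christoffel_flatConformal (hh.differentiable (by simp))]
  have hd : ∀ l, HasFDerivAt (pd l h) (fderiv ℝ (pd l h) y) y := fun l =>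
    ((contDiff_pd l hh).differentiable (by simp) y).hasFDerivAt
  have := (((hd i).const_mul (if k = j then 1 else 0)).fun_add
    ((hd j).const_mul (if k = i then 1 else 0))).fun_sub
    ((hd k).const_mul (if i = j then 1 else 0))
  rw [pd, this.fderiv]
  simp only [sub_apply, add_apply, smul_apply, smul_eq_mul, pd]

/-- The Ricci tensor of `e^{2h} δ`, traced with `δ`. -/
theorem sum_ricci_flatConformal {n : ℕ} {h : EuclideanSpace ℝ (Fin n) → ℝ}
    (hh : ContDiff ℝ ∞ h) (y : EuclideanSpace ℝ (Fin n)) :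
    ∑ i, ricci (flatConformal h) i i y =
      -(2 * ((n : ℝ) - 1)) * ∑ i, pd i (pd i h) y -
        ((n : ℝ) - 1) * ((n : ℝ) - 2) * ∑ i, pd i h y ^ 2 := by
  simp only [ricci, pd_christoffel_flatConformal hh]
  simp only [christoffel_flatConformal (hh.differentiable (by simp))]
  -- With the derivatives of `h` as opaque scalars, only Kronecker deltas have to be contracted.
  generalize hp : (fun i => pd i h y) = p
  generalize hH : (fun i j => pd i (pd j h) y) = H
  have hp' : ∀ i, pd i h y = p i := fun i => congrFun hp i
  have hH' : ∀ i j, pd i (pd j h) y = H i j := fun i j => congrFun (congrFun hH i) j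
  simp only [hp', hH']
  simp only [Finset.sum_add_distrib, Finset.sum_sub_distrib, mul_add, add_mul, mul_sub, sub_mul,
    ite_mul, mul_ite, one_mul, zero_mul, mul_one, mul_zero, Finset.sum_ite_eq, Finset.sum_ite_eq',
    Finset.mem_univ, if_true, Finset.sum_const, Finset.card_univ, Fintype.card_fin, nsmul_eq_mul]
  simp only [Finset.sum_ite_irrel, Finset.sum_const_zero, Finset.sum_ite_eq,
    Finset.mem_univ, if_true, Finset.sum_add_distrib, Finset.sum_sub_distrib, ← Finset.mul_sum,
    ← sq, Finset.sum_const, Finset.card_univ, Fintype.card_fin, nsmul_eq_mul]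
  ring

/-! ### The round metric in stereographic coordinates -/

theorem extChartAt_target_sph {n : ℕ} (x : Sph n) : (extChartAt (𝓡 n) x).target = Set.univ := by
  have := Fact.mk (@finrank_euclideanSpace_fin ℝ _ (n + 1))
  have h : (extChartAt (𝓡 n) x).target = (𝓡 n).symm ⁻¹' (stereographic' n (-x)).target ∩
    Set.range (𝓡 n) := extChartAt_target (𝓡 n) x
  rw [h]
  simp

/-- In the chart around `x`, the inverse of the coordinate map is stereographic: up to a linear
isometry `A` onto `xᗮ` it is `y ↦ (4 A y + (4 - |y|²) x) / (|y|² + 4)`. -/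
theorem exists_isometry_chart {n : ℕ} (x : Sph n) :
    ∃ A : EuclideanSpace ℝ (Fin n) →ₗᵢ[ℝ] Amb n, (∀ y, ⟪A y, (x : Amb n)⟫ = 0) ∧
      (∀ y, (((extChartAt (𝓡 n) x).symm y : Sph n) : Amb n) =
        (4 * (‖y‖ ^ 2 + 4)⁻¹) • ((x : Amb n) + A y - (‖y‖ ^ 2 / 4) • (x : Amb n))) ∧
      extChartAt (𝓡 n) x x = 0 := by
  have := Fact.mk (@finrank_euclideanSpace_fin ℝ _ (n + 1))
  let U : (ℝ ∙ ((-x : Sph n) : Amb n))ᗮ ≃ₗᵢ[ℝ] EuclideanSpace ℝ (Fin n) :=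
    (OrthonormalBasis.fromOrthogonalSpanSingleton n (ne_zero_of_mem_unit_sphere (-x))).repr
  let A : EuclideanSpace ℝ (Fin n) →ₗᵢ[ℝ] Amb n :=
    (ℝ ∙ ((-x : Sph n) : Amb n))ᗮ.subtypeₗᵢ.comp U.symm.toLinearIsometry
  have hsymm : ∀ y, (((extChartAt (𝓡 n) x).symm y : Sph n) : Amb n) =
        (4 * (‖y‖ ^ 2 + 4)⁻¹) • ((x : Amb n) + A y - (‖y‖ ^ 2 / 4) • (x : Amb n)) := by
    intro y
    have h1 := stereographic'_symm_apply (n := n) (-x) y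
    have h2 : (((extChartAt (𝓡 n) x).symm y : Sph n) : Amb n) =
      ((stereographic' n (-x)).symm y : Amb n) := rfl
    rw [h2, h1]
    change (‖A y‖ ^ 2 + 4)⁻¹ • (4 : ℝ) • A y + (‖A y‖ ^ 2 + 4)⁻¹ • (‖A y‖ ^ 2 - 4) •
      ((-x : Sph n) : Amb n) = _
    rw [A.norm_map, coe_neg_sphere]
    module
  have horth : ∀ y, ⟪A y, (x : Amb n)⟫ = 0 := by
    intro y
    have h1 : A y ∈ (ℝ ∙ ((-x : Sph n) : Amb n))ᗮ := (U.symm y).2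
    rw [Submodule.mem_orthogonal_singleton_iff_inner_left, coe_neg_sphere, inner_neg_right] at h1
    linarith
  refine ⟨A, horth, hsymm, ?_⟩
  have h0 : (extChartAt (𝓡 n) x).symm 0 = x := by
    ext1
    rw [hsymm]
    simp
  have h1 : (0 : EuclideanSpace ℝ (Fin n)) ∈ (extChartAt (𝓡 n) x).target := by
    rw [extChartAt_target_sph]
    trivial
  have h2 := (extChartAt (𝓡 n) x).right_inv h1
  rwa [h0] at h2

section Chart

variable {n : ℕ} {x : Sph n} {A : EuclideanSpace ℝ (Fin n) →ₗᵢ[ℝ] Amb n}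

theorem hasFDerivAt_stereoDenominator (y : EuclideanSpace ℝ (Fin n)) :
    HasFDerivAt (fun y : EuclideanSpace ℝ (Fin n) => 4 * (‖y‖ ^ 2 + 4)⁻¹)
      (-(8 * ((‖y‖ ^ 2 + 4)⁻¹) ^ 2) • innerSL ℝ y) y := by
  have hne : ‖y‖ ^ 2 + 4 ≠ 0 := by positivity
  have h1 := ((hasStrictFDerivAt_norm_sq y).hasFDerivAt.add_const 4)
  have h2 := ((hasDerivAt_inv hne).comp_hasFDerivAt y h1).const_mul 4
  refine h2.congr_fderiv ?_
  ext w
  simp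
  ring

theorem hasFDerivAt_stereoNumerator (y : EuclideanSpace ℝ (Fin n)) :
    HasFDerivAt (fun y => (x : Amb n) + A y - (‖y‖ ^ 2 / 4) • (x : Amb n))
      (A.toContinuousLinearMap - ((1 / 2 : ℝ) • innerSL ℝ y).smulRight (x : Amb n)) y := by
  have h1 := (hasStrictFDerivAt_norm_sq y).hasFDerivAt.const_mul (1 / 4)
  have h2 := (A.toContinuousLinearMap.hasFDerivAt (x := y)).const_add (x : Amb n)
  have h3 := h2.fun_sub (h1.smul_const (x : Amb n))
  refine (h3.congr_fderiv ?_).congr_of_eventuallyEq (Eventually.of_forall fun z => ?_)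
  · ext1 w
    simp
    congr 1
    ring
  · simp [div_eq_inv_mul]

/-- The inverse stereographic projection is conformal, with factor `4 / (|y|² + 4)`. -/
theorem inner_fderiv_stereo (hA : ∀ y, ⟪A y, (x : Amb n)⟫ = 0)
    (y v w : EuclideanSpace ℝ (Fin n)) :
    ⟪fderiv ℝ (fun y => (4 * (‖y‖ ^ 2 + 4)⁻¹) •
        ((x : Amb n) + A y - (‖y‖ ^ 2 / 4) • (x : Amb n))) y v,
      fderiv ℝ (fun y => (4 * (‖y‖ ^ 2 + 4)⁻¹) •
        ((x : Amb n) + A y - (‖y‖ ^ 2 / 4) • (x : Amb n))) y w⟫ =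
      (4 * (‖y‖ ^ 2 + 4)⁻¹) ^ 2 * ⟪v, w⟫ := by
  have h := (hasFDerivAt_stereoDenominator y).fun_smul (hasFDerivAt_stereoNumerator (x := x)
    (A := A) y)
  have hA' : ∀ y, ⟪(x : Amb n), A y⟫ = 0 := fun y => by rw [real_inner_comm, hA]
  have hxx : ⟪(x : Amb n), (x : Amb n)⟫ = 1 := by
    rw [real_inner_self_eq_norm_sq, norm_coe_sph]; norm_num
  rw [h.fderiv]
  have e : ∀ v, (((4 * (‖y‖ ^ 2 + 4)⁻¹) • (A.toContinuousLinearMap -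
      ((1 / 2 : ℝ) • innerSL ℝ y).smulRight (x : Amb n)) +
      (-(8 * ((‖y‖ ^ 2 + 4)⁻¹) ^ 2) • innerSL ℝ y).smulRight
        ((x : Amb n) + A y - (‖y‖ ^ 2 / 4) • (x : Amb n)) :
        EuclideanSpace ℝ (Fin n) →L[ℝ] Amb n)) v =
      (4 * (‖y‖ ^ 2 + 4)⁻¹) • (A v - (1 / 2 * ⟪y, v⟫) • (x : Amb n)) +
      (-(8 * ((‖y‖ ^ 2 + 4)⁻¹) ^ 2) * ⟪y, v⟫) •
        ((x : Amb n) + A y - (‖y‖ ^ 2 / 4) • (x : Amb n)) := fun v => by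
    simp
  rw [e, e]
  simp only [inner_add_left, inner_add_right, inner_sub_left, inner_sub_right,
    real_inner_smul_left, real_inner_smul_right, hA, hA', hxx, A.inner_map_map,
    real_inner_self_eq_norm_sq, real_inner_comm y v]
  have hne : ‖y‖ ^ 2 + 4 ≠ 0 := by positivity
  field_simp
  ring

end Chart

theorem inclDeriv_coordVec {n : ℕ} (x : Sph n) (y : EuclideanSpace ℝ (Fin n)) (i : Fin n) :
    inclDeriv n ((extChartAt (𝓡 n) x).symm y) (coordVec x y i) =
      fderiv ℝ (fun z => (((extChartAt (𝓡 n) x).symm z : Sph n) : Amb n)) y (basisVec i) := by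
  have := Fact.mk (@finrank_euclideanSpace_fin ℝ _ (n + 1))
  have h1 : MDifferentiableAt (𝓡 n) 𝓘(ℝ, Amb n) (fun y : Sph n => (y : Amb n))
      ((extChartAt (𝓡 n) x).symm y) :=
    (contMDiff_coe_sphere (m := 1)).mdifferentiable (by simp) _
  have h2 : MDifferentiableAt 𝓘(ℝ, EuclideanSpace ℝ (Fin n)) (𝓡 n)
      (extChartAt (𝓡 n) x).symm y := by
    have h3 := (contMDiffOn_extChartAt_symm (I := 𝓡 n) (n := 1) x)
    rw [extChartAt_target_sph] at h3
    exact ((contMDiffOn_univ.1 h3).mdifferentiable (by simp)) y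
  have h3 := mfderiv_comp y h1 h2
  rw [← mfderiv_eq_fderiv]
  change _ = (mfderiv 𝓘(ℝ, EuclideanSpace ℝ (Fin n)) 𝓘(ℝ, Amb n)
    ((fun y : Sph n => (y : Amb n)) ∘ (extChartAt (𝓡 n) x).symm) y) (basisVec i)
  rw [h3]
  rfl

theorem coordMetric_roundMetric {n : ℕ} (x : Sph n) (y : EuclideanSpace ℝ (Fin n)) (i j : Fin n) :
    roundMetric n ((extChartAt (𝓡 n) x).symm y) (coordVec x y i) (coordVec x y j) =
      if i = j then (4 * (‖y‖ ^ 2 + 4)⁻¹) ^ 2 else 0 := by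
  obtain ⟨A, hA, hs, -⟩ := exists_isometry_chart x
  rw [roundMetric, inclDeriv_coordVec, inclDeriv_coordVec, funext hs, inner_fderiv_stereo hA]
  simp [EuclideanSpace.inner_single_left]

/-- In the chart around `x`, the metric `e^{2f} g_{𝕊ⁿ}` is conformal to the flat metric. -/
theorem coordMetric_conformalMetric {n : ℕ} (f : Sph n → ℝ) (x : Sph n) :
    coordMetric (conformalMetric n f) x = flatConformal fun y =>
      f ((extChartAt (𝓡 n) x).symm y) + Real.log (4 * (‖y‖ ^ 2 + 4)⁻¹) := by
  funext y
  ext i j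
  have hpos : 0 < 4 * (‖y‖ ^ 2 + 4)⁻¹ := by positivity
  simp only [coordMetric, conformalMetric, flatConformal, Matrix.of_apply, coordMetric_roundMetric]
  have h2 : Real.exp (2 * Real.log (4 * (‖y‖ ^ 2 + 4)⁻¹)) = (4 * (‖y‖ ^ 2 + 4)⁻¹) ^ 2 := by
    rw [two_mul, Real.exp_add, Real.exp_log hpos]
    ring
  rw [mul_add, Real.exp_add, h2]
  simp

/-! ### The curvature inequality and the volume density -/

theorem totalVolume_conformalMetric {n : ℕ} (f : Sph n → ℝ) :
    totalVolume (conformalMetric n f) =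
      ∫⁻ x, ENNReal.ofReal (Real.exp (n * f x)) ∂(roundVolume n) := by
  refine lintegral_congr fun x => ?_
  congr 1
  have h0 : ∀ x : Sph n, (extChartAt (𝓡 n) x).symm (extChartAt (𝓡 n) x x) = x := fun x =>
    extChartAt_to_inv (I := 𝓡 n) x
  have h1 : coordMetric (conformalMetric n f) x (extChartAt (𝓡 n) x x) =
      Real.exp (2 * f x) • coordMetric (roundMetric n) x (extChartAt (𝓡 n) x x) := by
    ext i j
    simp only [coordMetric, conformalMetric, Matrix.of_apply, Matrix.smul_apply, smul_eq_mul, h0]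
  have h2 : coordMetric (roundMetric n) x (extChartAt (𝓡 n) x x) =
      ((4 * (‖extChartAt (𝓡 n) x x‖ ^ 2 + 4)⁻¹) ^ 2) • (1 : Matrix (Fin n) (Fin n) ℝ) := by
    ext i j
    simp only [coordMetric, Matrix.of_apply, coordMetric_roundMetric, Matrix.smul_apply,
      Matrix.one_apply]
    simp
  have hdet : 0 < (coordMetric (roundMetric n) x (extChartAt (𝓡 n) x x)).det := by
    rw [h2, Matrix.det_smul, Matrix.det_one]
    positivity
  rw [volumeDensity, h1, Matrix.det_smul, Real.sqrt_mul (by positivity),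
    mul_div_assoc, div_self (Real.sqrt_pos.2 hdet).ne', mul_one, Fintype.card_fin]
  have h3 : Real.exp (2 * f x) ^ n = Real.exp (n * f x) ^ 2 := by
    rw [← Real.exp_nat_mul, ← Real.exp_nat_mul]
    congr 1
    push_cast
    ring
  rw [h3, Real.sqrt_sq (Real.exp_pos _).le]

theorem scalarCurvature_conformalMetric {n : ℕ} (f : Sph n → ℝ) (x : Sph n)
    {h : EuclideanSpace ℝ (Fin n) → ℝ} (hh : ContDiff ℝ ∞ h)
    (he : coordMetric (conformalMetric n f) x = flatConformal h) :
    scalarCurvature (conformalMetric n f) x =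
      Real.exp (-(2 * h (extChartAt (𝓡 n) x x))) *
        (-(2 * ((n : ℝ) - 1)) * ∑ i, pd i (pd i h) (extChartAt (𝓡 n) x x) -
        ((n : ℝ) - 1) * ((n : ℝ) - 2) * ∑ i, pd i h (extChartAt (𝓡 n) x x) ^ 2) := by
  rw [← sum_ricci_flatConformal hh, scalarCurvature, he, Finset.mul_sum]
  refine Finset.sum_congr rfl fun i _ => ?_
  simp [flatConformal_inv]

/-- An orthonormal basis of `ℝⁿ⁺¹` consisting of the point `x` and of the coordinate directions
tangent to the sphere at `x`. -/
theorem exists_orthonormalBasis_cons {n : ℕ} (x : Sph n)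
    (A : EuclideanSpace ℝ (Fin n) →ₗᵢ[ℝ] Amb n) (hA : ∀ y, ⟪A y, (x : Amb n)⟫ = 0) :
    ∃ b : OrthonormalBasis (Fin (n + 1)) ℝ (Amb n), b 0 = (x : Amb n) ∧
      ∀ i : Fin n, b i.succ = A (basisVec i) := by
  let v : Fin (n + 1) → Amb n := Fin.cons (x : Amb n) (fun i => A (basisVec i))
  have hv : Orthonormal ℝ v := by
    rw [orthonormal_iff_ite]
    intro i j
    refine Fin.cases ?_ (fun i => ?_) i <;> refine Fin.cases ?_ (fun j => ?_) j
    · simp [v]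
    · simp [v, (Fin.succ_ne_zero j).symm, real_inner_comm (A (basisVec j)), hA]
    · simp [v, hA]
    · simp [v, A.inner_map_map, EuclideanSpace.inner_single_left]
  obtain ⟨b, hb⟩ := Orthonormal.exists_orthonormalBasis_extension_of_card_eq (𝕜 := ℝ)
    (s := Set.univ) (v := v) (by simp) (hv.comp _ Subtype.val_injective)
  exact ⟨b, by simpa [v] using hb 0 trivial, fun i => by simpa [v] using hb i.succ trivial⟩

/-- In terms of the extension `f̃` of `f` that is constant along rays, the scalar curvature of
`e^{2f} g_{𝕊ⁿ}` is nonnegative only if `2 Δ f + (n - 2) |∇ f|² ≤ n`; the Laplacian and the gradient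
are here computed in an orthonormal basis of the tangent space. -/
theorem sum_hessian_le_of_scalarCurvature_nonneg {n : ℕ} (hn : 2 ≤ n) {f : Sph n → ℝ}
    (hf : ContMDiff (𝓡 n) 𝓘(ℝ, ℝ) ∞ f) {x : Sph n}
    (hx : 0 ≤ scalarCurvature (conformalMetric n f) x) :
    ∃ A : EuclideanSpace ℝ (Fin n) →ₗᵢ[ℝ] Amb n, (∀ y, ⟪A y, (x : Amb n)⟫ = 0) ∧
      2 * ∑ i, fderiv ℝ (fderiv ℝ (radialExt f)) x (A (basisVec i)) (A (basisVec i)) +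
        ((n : ℝ) - 2) * ∑ i, fderiv ℝ (radialExt f) x (A (basisVec i)) ^ 2 ≤ n := by
  obtain ⟨A, hA, hs, h0⟩ := exists_isometry_chart x
  refine ⟨A, hA, ?_⟩
  set γ : EuclideanSpace ℝ (Fin n) → Amb n :=
    fun y => (x : Amb n) + A y - (‖y‖ ^ 2 / 4) • (x : Amb n) with hγ
  have hγ' : ∀ y, HasFDerivAt γ
      (A.toContinuousLinearMap - ((1 / 2 : ℝ) • innerSL ℝ y).smulRight (x : Amb n)) y :=
    fun y => hasFDerivAt_stereoNumerator y
  have hpos : ∀ y : EuclideanSpace ℝ (Fin n), 0 < 4 * (‖y‖ ^ 2 + 4)⁻¹ := fun y => by positivity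
  have hγ0 : ∀ y, γ y ≠ 0 := by
    intro y hy
    have h1 := hs y
    change _ = _ • γ y at h1
    rw [hy, smul_zero] at h1
    exact coe_sph_ne_zero _ h1
  have hγz : γ 0 = x := by simp [hγ]
  have hγs : ContDiff ℝ ∞ γ :=
    (contDiff_const.add A.contDiff).sub (((contDiff_norm_sq ℝ).div_const 4).smul contDiff_const)
  -- The point with coordinates `y` lies on the ray through `γ y`, so the conformal factor of the
  -- stereographic projection drops out of `f` in these coordinates.
  have hfγ : ∀ y, f ((extChartAt (𝓡 n) x).symm y) = radialExt f (γ y) := by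
    intro y
    rw [← radialExt_coe f, hs y, radialExt_pos_smul f (hpos y)]
  let h : EuclideanSpace ℝ (Fin n) → ℝ := fun y =>
    radialExt f (γ y) + Real.log (4 * (‖y‖ ^ 2 + 4)⁻¹)
  have hds : ContDiff ℝ ∞ fun y : EuclideanSpace ℝ (Fin n) => 4 * (‖y‖ ^ 2 + 4)⁻¹ :=
    contDiff_const.mul (((contDiff_norm_sq ℝ).add contDiff_const).inv fun y => by positivity)
  have hsm : ContDiff ℝ ∞ h := by
    refine ContDiff.add ?_ (hds.log fun y => (hpos y).ne')
    exact contDiff_iff_contDiffAt.2 fun y =>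
      (contDiffAt_radialExt hf (hγ0 y)).comp y hγs.contDiffAt
  have he : coordMetric (conformalMetric n f) x = flatConformal h := by
    rw [coordMetric_conformalMetric]
    congr 1
    funext y
    rw [hfγ]
  rw [scalarCurvature_conformalMetric f x hsm he, h0] at hx
  have hpd : ∀ i, pd i h = fun y => fderiv ℝ (radialExt f) (γ y)
      (A (basisVec i) - (1 / 2 * y i) • (x : Amb n)) - 2 * (‖y‖ ^ 2 + 4)⁻¹ * y i := by
    intro i
    funext y
    have h1 := ((contDiffAt_radialExt hf (hγ0 y)).differentiableAt (by simp)).hasFDerivAt.comp y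
      (hγ' y)
    have h2 := (hasFDerivAt_stereoDenominator y).log (hpos y).ne'
    have h3 : HasFDerivAt h _ y := h1.fun_add h2
    rw [pd, h3.fderiv]
    have hne : ‖y‖ ^ 2 + 4 ≠ 0 := by positivity
    have hyi : ⟪y, basisVec i⟫ = y i := by simp [EuclideanSpace.inner_single_right]
    simp [hyi]
    field_simp
    ring
  have hpd0 : ∀ i, pd i h 0 = fderiv ℝ (radialExt f) x (A (basisVec i)) := by
    intro i
    rw [hpd]
    simp [hγz]
  -- The derivative of `γ` turning towards `-x` contributes nothing, since the radial derivative of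
  -- the extension vanishes; the `-1/2` comes from the logarithm of the stereographic factor.
  have hpd2 : ∀ i, pd i (pd i h) 0 =
      fderiv ℝ (fderiv ℝ (radialExt f)) x (A (basisVec i)) (A (basisVec i)) - 1 / 2 := by
    intro i
    have h1 : HasFDerivAt (fun y => fderiv ℝ (radialExt f) (γ y)) _
        (0 : EuclideanSpace ℝ (Fin n)) :=
      HasFDerivAt.comp (0 : EuclideanSpace ℝ (Fin n)) (((contDiffAt_radialExt hf
      (hγ0 0)).fderiv_right (m := ∞) (by simp)).differentiableAt (by simp)).hasFDerivAt (hγ' 0)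
    have h2 : HasFDerivAt (fun y : EuclideanSpace ℝ (Fin n) => y i)
        (EuclideanSpace.proj i : EuclideanSpace ℝ (Fin n) →L[ℝ] ℝ) 0 :=
      (EuclideanSpace.proj i : EuclideanSpace ℝ (Fin n) →L[ℝ] ℝ).hasFDerivAt
    have h3 := ((h2.const_mul (1 / 2)).smul_const (x : Amb n)).const_sub (A (basisVec i))
    have h4 : HasFDerivAt (fun y : EuclideanSpace ℝ (Fin n) => 2 * (‖y‖ ^ 2 + 4)⁻¹)
        (0 : EuclideanSpace ℝ (Fin n) →L[ℝ] ℝ) 0 := by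
      have := (hasFDerivAt_stereoDenominator (0 : EuclideanSpace ℝ (Fin n))).const_mul (1 / 2)
      refine (this.congr_fderiv (by ext; simp)).congr_of_eventuallyEq
        (Eventually.of_forall fun y => ?_)
      simp only
      ring
    have h5 := (h1.clm_apply h3).fun_sub (h4.mul h2)
    have h6 := fderiv_radialExt_self hf (coe_sph_ne_zero x)
    rw [hpd, pd]
    have h7 := h5.fderiv
    simp only [Pi.mul_apply] at h7
    erw [h7]
    simp [hγz, h6]
    norm_num
  simp only [hpd0, hpd2, Finset.sum_sub_distrib, Finset.sum_const, Finset.card_univ,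
    Fintype.card_fin, nsmul_eq_mul] at hx
  set S := ∑ i, fderiv ℝ (fderiv ℝ (radialExt f)) x (A (basisVec i)) (A (basisVec i))
  set Q := ∑ i, fderiv ℝ (radialExt f) x (A (basisVec i)) ^ 2
  have hx' := nonneg_of_mul_nonneg_right hx (Real.exp_pos _)
  have hn' : (0 : ℝ) < (n : ℝ) - 1 := by
    have : (2 : ℝ) ≤ n := by exact_mod_cast hn
    linarith
  have h9 : 0 ≤ ((n : ℝ) - 1) * (n - 2 * S - ((n : ℝ) - 2) * Q) := by linarith
  have := nonneg_of_mul_nonneg_right h9 hn'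
  linarith

/-- Nonnegativity of the scalar curvature of `e^{2f} g_{𝕊ⁿ}` as a differential inequality on the
round sphere. -/
theorem sphereDiv_gradient_le {n : ℕ} (hn : 2 ≤ n) {f : Sph n → ℝ}
    (hf : ContMDiff (𝓡 n) 𝓘(ℝ, ℝ) ∞ f) {x : Sph n}
    (hx : 0 ≤ scalarCurvature (conformalMetric n f) x) :
    2 * sphereDiv (gradient (radialExt f)) x + ((n : ℝ) - 2) * ‖sphereGrad f x‖ ^ 2 ≤ n := by
  obtain ⟨A, hA, h⟩ := sum_hessian_le_of_scalarCurvature_nonneg hn hf hx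
  obtain ⟨b, hb0, hbs⟩ := exists_orthonormalBasis_cons x A hA
  have hx0 := coe_sph_ne_zero x
  have hF := contDiffAt_radialExt hf hx0
  have hgrad : ∀ v, ⟪sphereGrad f x, v⟫ = fderiv ℝ (radialExt f) x v := fun v =>
    ((hF.differentiableAt (by simp)).hasGradientAt.fderiv_apply (y := v)).symm
  -- The derivative of the gradient represents the second derivative.
  have hhess : ∀ v, ⟪fderiv ℝ (gradient (radialExt f)) x v, v⟫ =
      fderiv ℝ (fderiv ℝ (radialExt f)) x v v := by
    intro v
    have h1 := ((hF.fderiv_right (m := ∞) (by simp)).differentiableAt (by simp)).hasFDerivAt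
    have h2 : HasFDerivAt (gradient (radialExt f)) _ (x : Amb n) :=
      HasFDerivAt.comp (x : Amb n)
        ((InnerProductSpace.toDual ℝ (Amb n)).symm.toContinuousLinearEquiv.hasFDerivAt) h1
    rw [h2.fderiv]
    exact InnerProductSpace.toDual_symm_apply
  -- The trace over the tangent space is the trace over the basis without its vector `x`.
  have h1 : sphereDiv (gradient (radialExt f)) x =
      ∑ i, fderiv ℝ (fderiv ℝ (radialExt f)) x (A (basisVec i)) (A (basisVec i)) := by
    rw [sphereDiv, LinearMap.trace_eq_sum_inner _ b, Fin.sum_univ_succ, hb0]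
    simp only [hbs]
    rw [real_inner_comm (x : Amb n) (fderiv ℝ (gradient (radialExt f)) x x)]
    refine (add_sub_cancel_left _ _).trans (Finset.sum_congr rfl fun i _ => ?_)
    rw [← hhess, real_inner_comm]
    rfl
  have h2 : ‖sphereGrad f x‖ ^ 2 = ∑ i, fderiv ℝ (radialExt f) x (A (basisVec i)) ^ 2 := by
    rw [← b.sum_sq_norm_inner_left, Fin.sum_univ_succ, hb0]
    simp only [hbs, hgrad]
    rw [fderiv_radialExt_self hf hx0]
    simp
  rw [h1, h2]
  exact h

/-! ### Integration by parts on the sphere -/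

theorem integrable_of_continuous_sph {n : ℕ} {G : Type*} [NormedAddCommGroup G]
    [SecondCountableTopology G] {F : Sph n → G} (hF : Continuous F) :
    Integrable F (roundVolume n) := by
  obtain ⟨C, hC⟩ := isCompact_univ.exists_bound_of_continuousOn hF.continuousOn
  borelize G
  exact Integrable.of_bound hF.aestronglyMeasurable C
    (Eventually.of_forall fun x => hC x (Set.mem_univ x))

theorem sphereDiv_smul {n : ℕ} {a : Amb n → ℝ} {Y : Amb n → Amb n} {x : Sph n}
    (ha : DifferentiableAt ℝ a x) (hY : DifferentiableAt ℝ Y x) (ht : ⟪Y x, (x : Amb n)⟫ = 0) :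
    sphereDiv (fun z => a z • Y z) x = a x * sphereDiv Y x + fderiv ℝ a x (Y x) := by
  have h := (ha.hasFDerivAt.fun_smul hY.hasFDerivAt).fderiv
  have e : (a x • fderiv ℝ Y x + (fderiv ℝ a x).smulRight (Y x) :
      Amb n →L[ℝ] Amb n).toLinearMap =
      a x • (fderiv ℝ Y x).toLinearMap + (fderiv ℝ a x).toLinearMap.smulRight (Y x) := by
    ext1 w
    simp
  rw [sphereDiv, h, e, map_add, map_smul, LinearMap.trace_smulRight, sphereDiv]
  simp [inner_add_left, real_inner_smul_left, ht]
  ring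

theorem continuous_sphereDiv_of_contDiffAt {n : ℕ} {Y : Amb n → Amb n}
    (hY : ∀ z, z ≠ 0 → ContDiffAt ℝ ∞ Y z) : Continuous (sphereDiv Y) := by
  have h2 : Continuous fun x : Sph n => fderiv ℝ Y (x : Amb n) := by
    refine continuous_iff_continuousAt.2 fun x => ?_
    exact ContinuousAt.comp (f := fun x : Sph n => (x : Amb n))
      ((hY x (coe_sph_ne_zero x)).fderiv_right (m := ∞) (by simp)).continuousAt
      continuous_subtype_val.continuousAt
  have h3 : Continuous fun A : Amb n →L[ℝ] Amb n =>
      LinearMap.trace ℝ (Amb n) A.toLinearMap :=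
    LinearMap.continuous_of_finiteDimensional
      ((LinearMap.trace ℝ (Amb n)).comp (ContinuousLinearMap.coeLM ℝ))
  exact (h3.comp h2).sub ((h2.clm_apply continuous_subtype_val).inner continuous_subtype_val)

/-- Integration by parts on the sphere. -/
theorem integral_inner_sphereGrad {n : ℕ} {u : Sph n → ℝ} (hu : ContMDiff (𝓡 n) 𝓘(ℝ, ℝ) ∞ u)
    {Y : Amb n → Amb n} (hY : ∀ z, z ≠ 0 → ContDiffAt ℝ ∞ Y z)
    (ht : ∀ x : Sph n, ⟪Y x, (x : Amb n)⟫ = 0) :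
    ∫ x, ⟪sphereGrad u x, Y x⟫ ∂(roundVolume n) =
      - ∫ x, u x * sphereDiv Y x ∂(roundVolume n) := by
  have h1 := integral_sphereDiv_eq_zero (Y := fun z => radialExt u z • Y z)
    (fun z hz => ((contDiffAt_radialExt hu hz).smul (hY z hz)).of_le (by simp))
    (fun x => by rw [real_inner_smul_left, ht, mul_zero])
  have h2 : ∀ x : Sph n, sphereDiv (fun z => radialExt u z • Y z) x =
      u x * sphereDiv Y x + ⟪sphereGrad u x, Y x⟫ := by
    intro x
    have hx := coe_sph_ne_zero x
    have hd := (contDiffAt_radialExt hu hx).differentiableAt (by simp)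
    rw [sphereDiv_smul hd ((hY x hx).differentiableAt (by simp)) (ht x), radialExt_coe,
      hd.hasGradientAt.fderiv_apply]
    rfl
  simp_rw [h2] at h1
  have hYc : Continuous fun x : Sph n => Y x := continuous_iff_continuousAt.2 fun x =>
    ContinuousAt.comp (f := fun x : Sph n => (x : Amb n)) (hY x (coe_sph_ne_zero x)).continuousAt
      continuous_subtype_val.continuousAt
  rw [integral_add] at h1
  · linarith
  · exact integrable_of_continuous_sph (hu.continuous.mul (continuous_sphereDiv_of_contDiffAt hY))
  · exact integrable_of_continuous_sph ((continuous_sphereGrad hu).inner hYc)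

theorem isWeakGrad_sphereGrad {n : ℕ} {u : Sph n → ℝ} (hu : ContMDiff (𝓡 n) 𝓘(ℝ, ℝ) ∞ u) :
    IsWeakGrad u (sphereGrad u) :=
  ⟨Eventually.of_forall fun x => inner_sphereGrad_self hu x, fun _ hY =>
    integral_inner_sphereGrad hu (fun _ _ => hY.1.contDiffAt) hY.2⟩

/-- The chain rule for the gradient of a function on the sphere. -/
theorem sphereGrad_comp {n : ℕ} {u : Sph n → ℝ} (hu : ContMDiff (𝓡 n) 𝓘(ℝ, ℝ) ∞ u) {g : ℝ → ℝ}
    {x : Sph n} {g' : ℝ} (hg : HasDerivAt g g' (u x)) :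
    sphereGrad (fun x => g (u x)) x = g' • sphereGrad u x := by
  have hx := coe_sph_ne_zero x
  have h1 := ((contDiffAt_radialExt hu hx).differentiableAt (by simp)).hasFDerivAt
  have h2 : HasDerivAt g g' (radialExt u x) := by rwa [radialExt_coe]
  have h3 := (h2.comp_hasFDerivAt (x : Amb n) h1).congr_of_eventuallyEq
    (radialExt_comp_eventuallyEq u g hx)
  rw [sphereGrad_eq_gradient, sphereGrad_eq_gradient, gradient, h3.fderiv, map_smul]
  rfl

/-! ### Energy estimates -/

/-- The hypotheses on the conformal exponent: `f` is smooth, the metric `e^{2f} g_{𝕊ⁿ}` has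
nonnegative scalar curvature and volume at most `V`. -/
structure Admissible (n : ℕ) (V : ℝ) (f : Sph n → ℝ) : Prop where
  smooth : ContMDiff (𝓡 n) 𝓘(ℝ, ℝ) ∞ f
  nonneg : ∀ x, 0 ≤ scalarCurvature (conformalMetric n f) x
  volume_le : totalVolume (conformalMetric n f) ≤ ENNReal.ofReal V

theorem contMDiff_exp_mul {n : ℕ} {f : Sph n → ℝ} (hf : ContMDiff (𝓡 n) 𝓘(ℝ, ℝ) ∞ f) (β : ℝ) :
    ContMDiff (𝓡 n) 𝓘(ℝ, ℝ) ∞ fun x => Real.exp (β * f x) := by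
  have h : ContDiff ℝ ∞ fun t : ℝ => Real.exp (β * t) :=
    Real.contDiff_exp.comp (contDiff_const.mul contDiff_id)
  exact h.contMDiff.comp hf

theorem sphereGrad_exp_mul {n : ℕ} {f : Sph n → ℝ} (hf : ContMDiff (𝓡 n) 𝓘(ℝ, ℝ) ∞ f) (β : ℝ)
    (x : Sph n) :
    sphereGrad (fun x => Real.exp (β * f x)) x = (β * Real.exp (β * f x)) • sphereGrad f x := by
  refine sphereGrad_comp hf (g := fun t => Real.exp (β * t)) ?_
  have := ((hasDerivAt_id (f x)).const_mul β).exp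
  simpa [mul_comm] using this

/-- The energy estimate: multiplying the differential inequality
`2 Δ f + (n - 2) |∇ f|² ≤ n` by `e^{βf}` and integrating by parts. -/
theorem mul_integral_exp_mul_norm_sphereGrad_sq_le {n : ℕ} (hn : 2 ≤ n) {f : Sph n → ℝ}
    (hf : ContMDiff (𝓡 n) 𝓘(ℝ, ℝ) ∞ f)
    (hx : ∀ x, 0 ≤ scalarCurvature (conformalMetric n f) x) (β : ℝ) :
    ((n : ℝ) - 2 - 2 * β) * ∫ x, Real.exp (β * f x) * ‖sphereGrad f x‖ ^ 2 ∂(roundVolume n) ≤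
      n * ∫ x, Real.exp (β * f x) ∂(roundVolume n) := by
  have hgr : ∀ z, z ≠ 0 → ContDiffAt ℝ ∞ (gradient (radialExt f)) z := fun z hz =>
    contDiffAt_gradient_radialExt hf hz
  have h1 := integral_inner_sphereGrad (contMDiff_exp_mul hf β) hgr
    (fun x => inner_sphereGrad_self hf x)
  have hce : Continuous fun x => Real.exp (β * f x) := (contMDiff_exp_mul hf β).continuous
  have hcg : Continuous fun x => Real.exp (β * f x) * ‖sphereGrad f x‖ ^ 2 :=
    hce.mul ((continuous_sphereGrad hf).norm.pow 2)
  have hcd : Continuous fun x : Sph n => Real.exp (β * f x) *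
      sphereDiv (gradient (radialExt f)) x :=
    hce.mul (continuous_sphereDiv_of_contDiffAt hgr)
  have h2 : ∫ x, ⟪sphereGrad (fun x => Real.exp (β * f x)) x, gradient (radialExt f) (x : Amb n)⟫
      ∂(roundVolume n) =
      β * ∫ x, Real.exp (β * f x) * ‖sphereGrad f x‖ ^ 2 ∂(roundVolume n) := by
    rw [← integral_const_mul]
    refine integral_congr_ae (Eventually.of_forall fun x => ?_)
    simp only
    rw [sphereGrad_exp_mul hf, ← sphereGrad_eq_gradient, real_inner_smul_left,
      real_inner_self_eq_norm_sq]
    ring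
  rw [h2] at h1
  have h3 : ∫ x, (2 * (Real.exp (β * f x) * sphereDiv (gradient (radialExt f)) x) +
      ((n : ℝ) - 2) * (Real.exp (β * f x) * ‖sphereGrad f x‖ ^ 2)) ∂(roundVolume n) ≤
      ∫ x, n * Real.exp (β * f x) ∂(roundVolume n) := by
    refine integral_mono
      (integrable_of_continuous_sph ((hcd.const_smul (2 : ℝ)).add
        (hcg.const_smul ((n : ℝ) - 2))))
      (integrable_of_continuous_sph (hce.const_smul (n : ℝ))) fun x => ?_
    have := mul_le_mul_of_nonneg_left (sphereDiv_gradient_le hn hf (hx x))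
      (Real.exp_pos (β * f x)).le
    simp only
    linarith
  rw [integral_add ((integrable_of_continuous_sph hcd).const_mul 2)
    ((integrable_of_continuous_sph hcg).const_mul _), integral_const_mul, integral_const_mul,
    integral_const_mul] at h3
  linarith

/-- The volume bound controls all the powers `e^{βf}` with `0 ≤ β ≤ n`, since
`e^{βf} ≤ 1 + e^{nf}`. -/
theorem integral_exp_mul_le {n : ℕ} {V : ℝ} (hV : 0 < V) {f : Sph n → ℝ} (hf : Admissible n V f)
    {β : ℝ} (h0 : 0 ≤ β) (hβ : β ≤ n) :
    ∫ x, Real.exp (β * f x) ∂(roundVolume n) ≤ (roundVolume n).real Set.univ + V := by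
  have hc : ∀ β : ℝ, Integrable (fun x => Real.exp (β * f x)) (roundVolume n) := fun β =>
    integrable_of_continuous_sph (contMDiff_exp_mul hf.smooth β).continuous
  have h1 : ∫ x, Real.exp (n * f x) ∂(roundVolume n) ≤ V := by
    have h := hf.volume_le
    rw [totalVolume_conformalMetric, ← ofReal_integral_eq_lintegral_ofReal (hc n)
      (Eventually.of_forall fun x => (Real.exp_pos _).le)] at h
    exact (ENNReal.ofReal_le_ofReal_iff hV.le).1 h
  have h2 : ∫ x, Real.exp (β * f x) ∂(roundVolume n) ≤
      ∫ x, (1 + Real.exp (n * f x)) ∂(roundVolume n) := by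
    refine integral_mono (hc β) ((integrable_const _).add (hc n)) fun x => ?_
    simp only
    rcases le_total (f x) 0 with hfx | hfx
    · have : Real.exp (β * f x) ≤ 1 := by
        rw [Real.exp_le_one_iff]
        exact mul_nonpos_of_nonneg_of_nonpos h0 hfx
      have := Real.exp_pos (n * f x)
      linarith
    · have : Real.exp (β * f x) ≤ Real.exp (n * f x) :=
        Real.exp_le_exp.2 (mul_le_mul_of_nonneg_right hβ hfx)
      linarith
  rw [integral_add (integrable_const _) (hc n), integral_const, smul_eq_mul, mul_one] at h2
  linarith

theorem integral_exp_mul_norm_sphereGrad_sq_le {n : ℕ} (hn : 3 ≤ n) {V : ℝ} (hV : 0 < V)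
    {f : Sph n → ℝ} (hf : Admissible n V f) {β : ℝ} (h0 : 0 ≤ β) (hβ : 2 * β < (n : ℝ) - 2) :
    ∫ x, Real.exp (β * f x) * ‖sphereGrad f x‖ ^ 2 ∂(roundVolume n) ≤
      n * ((roundVolume n).real Set.univ + V) / ((n : ℝ) - 2 - 2 * β) := by
  rw [le_div_iff₀ (by linarith), mul_comm]
  refine (mul_integral_exp_mul_norm_sphereGrad_sq_le (by omega) hf.smooth hf.nonneg β).trans ?_
  refine mul_le_mul_of_nonneg_left (integral_exp_mul_le hV hf h0 (by linarith)) (by positivity)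

/-- The gradient of `e^{(n-2)f/2}` is the product of `e^{βf/2} ∇f`, which is bounded in `L²`, and a
power of `e^f`. -/
theorem sphereGrad_factor {n : ℕ} {f : Sph n → ℝ} (hf : ContMDiff (𝓡 n) 𝓘(ℝ, ℝ) ∞ f) (β : ℝ)
    (x : Sph n) :
    sphereGrad (factor n f) x = (((n : ℝ) - 2) / 2 * Real.exp (((n : ℝ) - 2 - β) / 2 * f x)) •
      (Real.exp (β / 2 * f x) • sphereGrad f x) := by
  have := sphereGrad_exp_mul hf (((n : ℝ) - 2) / 2) x
  rw [smul_smul, mul_assoc, ← Real.exp_add]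
  refine this.trans ?_
  congr 3
  ring

theorem contMDiff_factor {n : ℕ} {f : Sph n → ℝ} (hf : ContMDiff (𝓡 n) 𝓘(ℝ, ℝ) ∞ f) :
    ContMDiff (𝓡 n) 𝓘(ℝ, ℝ) ∞ (factor n f) := contMDiff_exp_mul hf _

/-- The gradient of `e^{(n-2)f/2}` is bounded in `L^q` for `q < 4n / (3n - 2)`: by Young's
inequality `|∇ e^{(n-2)f/2}|^q` is at most a constant times `e^{βf} |∇f|² + e^{κf}` with
`κ = (n - 2 - β) q / (2 - q)`. -/
theorem exists_integral_norm_sphereGrad_factor_rpow_le {n : ℕ} (hn : 3 ≤ n) {V : ℝ} (hV : 0 < V)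
    {q : ℝ} (hq1 : 1 ≤ q) (hq : q < 4 * (n : ℝ) / (3 * (n : ℝ) - 2)) :
    ∃ C : ℝ, ∀ f : Sph n → ℝ, Admissible n V f →
      Integrable (fun x => ‖sphereGrad (factor n f) x‖ ^ q) (roundVolume n) ∧
        ∫ x, ‖sphereGrad (factor n f) x‖ ^ q ∂(roundVolume n) ≤ C := by
  have hn' : (3 : ℝ) ≤ n := by exact_mod_cast hn
  rw [lt_div_iff₀ (by linarith)] at hq
  have hq2 : q < 2 := by nlinarith
  -- `β` is the least nonnegative exponent for which `κ ≤ n`; that `2β < n - 2` is the condition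
  -- on `q`.
  set β : ℝ := max 0 ((n : ℝ) - 2 - n * (2 - q) / q) with hβ
  have hβ0 : 0 ≤ β := le_max_left _ _
  have hβ1 : 2 * β < (n : ℝ) - 2 := by
    have h1 : 2 * ((n : ℝ) - 2 - n * (2 - q) / q) < (n : ℝ) - 2 := by
      have : ((n : ℝ) - 2) / 2 < n * (2 - q) / q := by
        rw [div_lt_div_iff₀ (by norm_num) (by linarith)]
        nlinarith
      linarith
    rcases max_choice 0 ((n : ℝ) - 2 - n * (2 - q) / q) with h | h
    · rw [hβ, h]; linarith
    · rw [hβ, h]; exact h1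
  have hβ2 : ((n : ℝ) - 2 - β) * q / (2 - q) ≤ n := by
    rw [div_le_iff₀ (by linarith), ← le_div_iff₀ (by linarith)]
    have := le_max_right 0 ((n : ℝ) - 2 - n * (2 - q) / q)
    rw [← hβ] at this
    linarith
  set κ : ℝ := ((n : ℝ) - 2 - β) * q / (2 - q) with hκ
  have hκ0 : 0 ≤ κ := by
    refine div_nonneg (mul_nonneg ?_ ?_) ?_ <;> linarith
  set M := (roundVolume n).real Set.univ + V
  refine ⟨(((n : ℝ) - 2) / 2) ^ q * (n * M / ((n : ℝ) - 2 - 2 * β) + M), fun f hf => ?_⟩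
  have hgc := continuous_sphereGrad (contMDiff_factor hf.smooth)
  have hc1 : Continuous fun x => Real.exp (β * f x) * ‖sphereGrad f x‖ ^ 2 :=
    (contMDiff_exp_mul hf.smooth β).continuous.mul ((continuous_sphereGrad hf.smooth).norm.pow 2)
  have hc2 : Continuous fun x => Real.exp (κ * f x) :=
    (contMDiff_exp_mul hf.smooth κ).continuous
  have hint : Integrable (fun x => ‖sphereGrad (factor n f) x‖ ^ q) (roundVolume n) :=
    integrable_of_continuous_sph (hgc.norm.rpow_const fun x => Or.inr (by linarith))
  refine ⟨hint, ?_⟩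
  have hpt : ∀ x, ‖sphereGrad (factor n f) x‖ ^ q ≤ (((n : ℝ) - 2) / 2) ^ q *
      (Real.exp (β * f x) * ‖sphereGrad f x‖ ^ 2 + Real.exp (κ * f x)) := by
    intro x
    rw [sphereGrad_factor hf.smooth β x, norm_smul, norm_smul, norm_mul,
      Real.norm_of_nonneg (Real.exp_pos _).le, Real.norm_of_nonneg (Real.exp_pos _).le,
      Real.norm_of_nonneg (by linarith), mul_assoc, Real.mul_rpow (by linarith) (by positivity),
      mul_comm (Real.exp (((n : ℝ) - 2 - β) / 2 * f x)),
      Real.mul_rpow (by positivity) (by positivity)]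
    refine mul_le_mul_of_nonneg_left ?_ (Real.rpow_nonneg (by linarith) _)
    set a := Real.exp (β / 2 * f x) * ‖sphereGrad f x‖ with ha
    have ha0 : 0 ≤ a := by positivity
    have hpq : (2 / q).HolderConjugate (2 / (2 - q)) := by
      rw [Real.holderConjugate_iff]
      refine ⟨by rw [lt_div_iff₀ (by linarith)]; linarith, ?_⟩
      rw [inv_div, inv_div]
      ring
    have hY := Real.young_inequality_of_nonneg (a := a ^ q)
      (b := Real.exp (((n : ℝ) - 2 - β) / 2 * f x) ^ q) (by positivity) (by positivity) hpq
    have e1 : (a ^ q) ^ (2 / q) = Real.exp (β * f x) * ‖sphereGrad f x‖ ^ 2 := by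
      rw [← Real.rpow_mul ha0, mul_div_cancel₀ _ (by linarith), Real.rpow_two, ha, mul_pow, sq,
        ← Real.exp_add]
      congr 2
      ring
    have e2 : (Real.exp (((n : ℝ) - 2 - β) / 2 * f x) ^ q) ^ (2 / (2 - q)) =
        Real.exp (κ * f x) := by
      rw [← Real.exp_mul, ← Real.exp_mul, hκ]
      congr 1
      field_simp
    rw [e1, e2] at hY
    refine hY.trans (add_le_add ?_ ?_)
    · refine div_le_self (by positivity) ?_
      rw [le_div_iff₀ (by linarith)]
      linarith
    · refine div_le_self (by positivity) ?_
      rw [le_div_iff₀ (by linarith)]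
      linarith
  have hint' : Integrable (fun x => (((n : ℝ) - 2) / 2) ^ q *
      (Real.exp (β * f x) * ‖sphereGrad f x‖ ^ 2 + Real.exp (κ * f x))) (roundVolume n) :=
    integrable_of_continuous_sph (continuous_const.mul (hc1.add hc2))
  refine (integral_mono hint hint' hpt).trans ?_
  rw [integral_const_mul]
  refine mul_le_mul_of_nonneg_left ?_ (Real.rpow_nonneg (by linarith) _)
  rw [integral_add (integrable_of_continuous_sph hc1) (integrable_of_continuous_sph hc2)]
  exact add_le_add (integral_exp_mul_norm_sphereGrad_sq_le hn hV hf hβ0 hβ1)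
    (integral_exp_mul_le hV hf hκ0 hβ2)

/-! ### Weak compactness in Hilbert spaces -/

/-- Countably many bounded sequences in a separable Hilbert space converge weakly along a common
subsequence. -/
theorem exists_subseq_tendsto_inner {H : Type*} [NormedAddCommGroup H] [InnerProductSpace ℝ H]
    [CompleteSpace H] [TopologicalSpace.SeparableSpace H] {F : ℕ → ℕ → H} {C : ℕ → ℝ}
    (hF : ∀ m j, ‖F m j‖ ≤ C m) :
    ∃ φ : ℕ → ℕ, StrictMono φ ∧ ∃ G : ℕ → H, ∀ m y,
      Tendsto (fun j => ⟪F m (φ j), y⟫) atTop (𝓝 ⟪G m, y⟫) := by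
  let K : ℕ → Set (WeakDual ℝ H) := fun m => WeakDual.toStrongDual ⁻¹' Metric.closedBall 0 (C m)
  have hK : ∀ m, IsCompact (K m) := fun m => WeakDual.isCompact_closedBall 0 (C m)
  have hKc : ∀ m, CompactSpace (K m) := fun m => isCompact_iff_compactSpace.1 (hK m)
  have hKm : ∀ m, TopologicalSpace.MetrizableSpace (K m) := fun m =>
    WeakDual.metrizable_of_isCompact ℝ H (K m) (hK m)
  let D : H → WeakDual ℝ H := fun v => StrongDual.toWeakDual (InnerProductSpace.toDual ℝ H v)
  have hD : ∀ m j, D (F m j) ∈ K m := by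
    intro m j
    have : ‖InnerProductSpace.toDual ℝ H (F m j)‖ ≤ C m := by
      rw [LinearIsometryEquiv.norm_map]
      exact hF m j
    simpa [K, D] using this
  -- Balls in the dual are weak-* compact and metrizable, hence so is their countable product.
  obtain ⟨a, φ, hφ, ha⟩ := CompactSpace.tendsto_subseq
    (fun j => (fun m => ⟨D (F m j), hD m j⟩ : ∀ m, K m))
  refine ⟨φ, hφ, fun m => (InnerProductSpace.toDual ℝ H).symm (WeakDual.toStrongDual (a m).1),
    fun m y => ?_⟩
  have h1 : Tendsto (fun j => D (F m (φ j))) atTop (𝓝 (a m).1) :=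
    (continuous_subtype_val.tendsto _).comp ((tendsto_pi_nhds.1 ha) m)
  have h2 := ((WeakDual.eval_continuous y).tendsto _).comp h1
  rw [InnerProductSpace.toDual_symm_apply]
  exact h2

/-! ### A Rellich compactness theorem -/

/-- Translating a compactly supported `C¹` function by `h` changes it in `L¹` by at most
`‖h‖ ∫ ‖DW‖`. -/
theorem integral_abs_translate_sub_le {n : ℕ} {W : Amb n → ℝ} (hW : ContDiff ℝ 1 W)
    (hc : HasCompactSupport W) (h : Amb n) :
    ∫ z, |W (z - h) - W z| ≤ ‖h‖ * ∫ z, ‖fderiv ℝ W z‖ := by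
  have hDc : Continuous (fderiv ℝ W) := hW.continuous_fderiv (by simp)
  have hD : Integrable (fun z => ‖fderiv ℝ W z‖) :=
    (hDc.integrable_of_hasCompactSupport (hc.fderiv ℝ)).norm
  have hWi : Integrable W := hW.continuous.integrable_of_hasCompactSupport hc
  have hcont : Continuous fun p : Amb n × ℝ => ‖fderiv ℝ W (p.1 - p.2 • h)‖ := by fun_prop
  have htr : ∀ t : ℝ, ∫ z, ‖fderiv ℝ W (z - t • h)‖ = ∫ z, ‖fderiv ℝ W z‖ := fun t =>
    integral_sub_right_eq_self (fun z => ‖fderiv ℝ W z‖) (t • h)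
  have hprod : Integrable (fun p : Amb n × ℝ => ‖fderiv ℝ W (p.1 - p.2 • h)‖)
      ((volume : Measure (Amb n)).prod (volume.restrict (Set.Ioc (0 : ℝ) 1))) := by
    refine (integrable_prod_iff' hcont.aestronglyMeasurable).2 ⟨?_, ?_⟩
    · exact Eventually.of_forall fun t => hD.comp_sub_right (t • h)
    · simp only [norm_norm, htr]
      exact integrable_const _
  have hpt : ∀ z, |W (z - h) - W z| ≤
      ‖h‖ * ∫ t in Set.Ioc (0 : ℝ) 1, ‖fderiv ℝ W (z - t • h)‖ := by
    intro z
    have hd : ∀ t : ℝ, HasDerivAt (fun t : ℝ => W (z - t • h)) (fderiv ℝ W (z - t • h) (-h)) t := by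
      intro t
      have h1 : HasDerivAt (fun t : ℝ => z - t • h) (-h) t := by
        simpa using ((hasDerivAt_id t).smul_const h).const_sub z
      exact (hW.differentiable (by simp) _).hasFDerivAt.comp_hasDerivAt t h1
    have hct : Continuous fun t : ℝ => fderiv ℝ W (z - t • h) (-h) :=
      (hDc.comp (by fun_prop)).clm_apply continuous_const
    have h2 := intervalIntegral.integral_eq_sub_of_hasDerivAt (a := 0) (b := 1)
      (fun t _ => hd t) (hct.intervalIntegrable 0 1)
    simp only [one_smul, zero_smul, sub_zero] at h2
    rw [← h2, intervalIntegral.integral_of_le zero_le_one, ← Real.norm_eq_abs,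
      ← integral_const_mul]
    refine norm_integral_le_of_norm_le ?_ (Eventually.of_forall fun t => ?_)
    · have : Continuous fun t : ℝ => ‖h‖ * ‖fderiv ℝ W (z - t • h)‖ := by fun_prop
      exact (this.intervalIntegrable 0 1).1
    · rw [mul_comm]
      simpa using (fderiv ℝ W (z - t • h)).le_opNorm (-h)
  calc ∫ z, |W (z - h) - W z|
      ≤ ∫ z, ‖h‖ * ∫ t in Set.Ioc (0 : ℝ) 1, ‖fderiv ℝ W (z - t • h)‖ :=
        integral_mono ((hWi.comp_sub_right h).sub hWi).abs (hprod.integral_prod_left.const_mul _)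
          hpt
    _ = ‖h‖ * ∫ z, ‖fderiv ℝ W z‖ := by
        rw [integral_const_mul, integral_integral_swap hprod]
        simp [htr]

/-- The standard mollifier at scale `δ`. -/
def mollifier (n : ℕ) {δ : ℝ} (hδ : 0 < δ) : ContDiffBump (0 : Amb n) :=
  ⟨δ / 2, δ, by linarith, by linarith⟩

/-- Mollification at scale `δ` changes a compactly supported `C¹` function in `L¹` by at most
`δ ∫ ‖DW‖`. -/
theorem integral_abs_mollify_sub_le {n : ℕ} {W : Amb n → ℝ} (hW : ContDiff ℝ 1 W) {R : ℝ}
    (hs : ∀ z ∉ Metric.closedBall 0 R, W z = 0) {δ : ℝ} (hδ : 0 < δ) :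
    ∫ z, |(∫ y, (mollifier n hδ).normed volume (z - y) * W y) - W z| ≤
      δ * ∫ z, ‖fderiv ℝ W z‖ := by
  have hc : HasCompactSupport W := HasCompactSupport.intro (isCompact_closedBall 0 R) hs
  set ρ := (mollifier n hδ).normed volume with hρ
  have hρc : Continuous ρ := (mollifier n hδ).continuous_normed
  have hρ0 : ∀ z, 0 ≤ ρ z := fun z => (mollifier n hδ).nonneg_normed z
  have hρ1 : ∫ z, ρ z = 1 := (mollifier n hδ).integral_normed
  have hρcs : HasCompactSupport ρ := (mollifier n hδ).hasCompactSupport_normed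
  have hρi : Integrable ρ := hρc.integrable_of_hasCompactSupport hρcs
  have hρs : ∀ h, δ < ‖h‖ → ρ h = 0 := by
    intro h hh
    have : h ∉ Function.support ρ := by
      rw [hρ, (mollifier n hδ).support_normed_eq]
      simp only [mollifier, Metric.mem_ball, dist_zero_right, not_lt]
      exact hh.le
    simpa using this
  have hWi : Integrable W := hW.continuous.integrable_of_hasCompactSupport hc
  have hcont : Continuous fun p : Amb n × Amb n => ρ p.2 * |W (p.1 - p.2) - W p.1| := by
    have := hW.continuous
    fun_prop
  have hprod : Integrable (fun p : Amb n × Amb n => ρ p.2 * |W (p.1 - p.2) - W p.1|)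
      ((volume : Measure (Amb n)).prod volume) := by
    refine hcont.integrable_of_hasCompactSupport ?_
    refine HasCompactSupport.intro
      ((isCompact_closedBall (0 : Amb n) (R + δ)).prod (isCompact_closedBall (0 : Amb n) δ)) ?_
    rintro ⟨z, h⟩ hzh
    simp only [Set.mem_prod, Metric.mem_closedBall, dist_zero_right, not_and_or, not_le] at hzh
    by_cases hh : δ < ‖h‖
    · simp [hρs h hh]
    · have hz := hzh.resolve_right hh
      have h1 : W z = 0 := hs z (by simp; linarith)
      have h2 : W (z - h) = 0 := hs _ (by
        have := norm_sub_norm_le z h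
        simp; linarith)
      simp [h1, h2]
  have hpt : ∀ z, |(∫ y, ρ (z - y) * W y) - W z| ≤ ∫ h, ρ h * |W (z - h) - W z| := by
    intro z
    have h1 : ∫ y, ρ (z - y) * W y = ∫ h, ρ h * W (z - h) := by
      rw [← integral_sub_left_eq_self (fun h => ρ h * W (z - h)) volume z]
      simp
    have h2 : W z = ∫ h, ρ h * W z := by rw [integral_mul_const, hρ1, one_mul]
    have hi : Integrable fun h => ρ h * W (z - h) := by
      refine Continuous.integrable_of_hasCompactSupport ?_ hρcs.mul_right
      have := hW.continuous
      fun_prop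
    rw [h1, h2, ← integral_sub hi (hρi.mul_const _), ← h2, ← Real.norm_eq_abs]
    refine (norm_integral_le_integral_norm _).trans (le_of_eq ?_)
    refine integral_congr_ae (Eventually.of_forall fun h => ?_)
    simp only
    rw [← mul_sub, norm_mul, Real.norm_of_nonneg (hρ0 h), Real.norm_eq_abs]
  have hmeas : AEStronglyMeasurable fun z => |(∫ y, ρ (z - y) * W y) - W z| := by
    have h1 : StronglyMeasurable fun p : Amb n × Amb n => ρ (p.1 - p.2) * W p.2 := by
      have := hW.continuous
      exact Continuous.stronglyMeasurable (by fun_prop)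
    have h2 := (h1.integral_prod_right' (ν := (volume : Measure (Amb n)))).aestronglyMeasurable
      (μ := (volume : Measure (Amb n)))
    exact (h2.sub hW.continuous.aestronglyMeasurable).norm
  calc ∫ z, |(∫ y, ρ (z - y) * W y) - W z|
      ≤ ∫ z, ∫ h, ρ h * |W (z - h) - W z| := by
        refine integral_mono (hprod.integral_prod_left.mono' hmeas
          (Eventually.of_forall fun z => ?_)) hprod.integral_prod_left hpt
        simpa using hpt z
    _ = ∫ h, ρ h * ∫ z, |W (z - h) - W z| := by
        rw [integral_integral_swap hprod]
        simp_rw [integral_const_mul]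
    _ ≤ ∫ h, ρ h * (δ * ∫ z, ‖fderiv ℝ W z‖) := by
        refine integral_mono ?_ (hρi.mul_const _) fun h => ?_
        · have := hprod.integral_prod_right
          simpa only [integral_const_mul] using this
        · by_cases hh : δ < ‖h‖
          · simp [hρs h hh]
          · refine mul_le_mul_of_nonneg_left ?_ (hρ0 h)
            exact (integral_abs_translate_sub_le hW hc h).trans
              (mul_le_mul_of_nonneg_right (not_lt.1 hh) (integral_nonneg fun _ => norm_nonneg _))
    _ = δ * ∫ z, ‖fderiv ℝ W z‖ := by rw [integral_mul_const, hρ1, one_mul]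

/-- A Rellich compactness theorem: `C¹` functions supported in a common ball, bounded in `L²` and
with gradients bounded in `L¹`, have a subsequence that is Cauchy in `L¹`.  Along a weakly
`L²`-convergent subsequence the mollifications at a fixed scale converge pointwise, hence in `L¹`,
and they are uniformly close to the functions themselves. -/
theorem exists_subseq_cauchy_integral_abs_sub {n : ℕ} {U : ℕ → Amb n → ℝ}
    (hU : ∀ j, ContDiff ℝ 1 (U j)) {R C : ℝ} (hs : ∀ j, ∀ z ∉ Metric.closedBall 0 R, U j z = 0)
    (h2 : ∀ j, ∫ z, U j z ^ 2 ≤ C) (h1 : ∀ j, ∫ z, ‖fderiv ℝ (U j) z‖ ≤ C) :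
    ∃ φ : ℕ → ℕ, StrictMono φ ∧ ∀ ε > 0, ∃ N, ∀ j ≥ N, ∀ k ≥ N,
      ∫ z, |U (φ j) z - U (φ k) z| ≤ ε := by
  have hc : ∀ j, HasCompactSupport (U j) := fun j =>
    HasCompactSupport.intro (isCompact_closedBall 0 R) (hs j)
  have hm : ∀ j, MemLp (U j) 2 := fun j => (hU j).continuous.memLp_of_hasCompactSupport (hc j)
  have hUi : ∀ j, Integrable (U j) := fun j =>
    (hU j).continuous.integrable_of_hasCompactSupport (hc j)
  have hnorm : ∀ j, ‖(hm j).toLp‖ ≤ Real.sqrt C := by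
    intro j
    refine Real.le_sqrt_of_sq_le ?_
    rw [← real_inner_self_eq_norm_sq, L2.inner_def]
    refine le_trans (le_of_eq (integral_congr_ae ?_)) (h2 j)
    filter_upwards [(hm j).coeFn_toLp] with z hz
    rw [hz]
    simp [sq]
  have : Fact ((2 : ℝ≥0∞) ≠ ⊤) := ⟨ENNReal.ofNat_ne_top⟩
  have : TopologicalSpace.SeparableSpace (Lp ℝ 2 (volume : Measure (Amb n))) := inferInstance
  obtain ⟨φ, hφ, G, hG⟩ := exists_subseq_tendsto_inner (F := fun _ j => (hm j).toLp)
    (C := fun _ => Real.sqrt C) (fun _ j => hnorm j)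
  refine ⟨φ, hφ, fun ε hε => ?_⟩
  -- The scale of mollification: the error `2δC` is at most `ε / 2`.
  obtain ⟨δ, hδ, hδε⟩ : ∃ δ > 0, δ * C ≤ ε / 4 := by
    refine ⟨ε / (4 * (|C| + 1)), by positivity, ?_⟩
    rw [div_mul_eq_mul_div, div_le_div_iff₀ (by positivity) (by norm_num)]
    have := le_abs_self C
    nlinarith
  set ρ := (mollifier n hδ).normed volume with hρ
  have hρc : Continuous ρ := (mollifier n hδ).continuous_normed
  have hρcs : HasCompactSupport ρ := (mollifier n hδ).hasCompactSupport_normed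
  have hρs : ∀ h, δ ≤ ‖h‖ → ρ h = 0 := by
    intro h hh
    have : h ∉ Function.support ρ := by
      rw [hρ, (mollifier n hδ).support_normed_eq]
      simp only [mollifier, Metric.mem_ball, dist_zero_right, not_lt]
      exact hh
    simpa using this
  have hρz : ∀ z, Continuous fun y => ρ (z - y) := fun z => by fun_prop
  have hρzc : ∀ z, HasCompactSupport fun y => ρ (z - y) := fun z =>
    hρcs.comp_homeomorph (Homeomorph.subLeft z)
  have hρm : ∀ z, MemLp (fun y => ρ (z - y)) 2 := fun z =>
    (hρz z).memLp_of_hasCompactSupport (hρzc z)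
  let m : ℕ → Amb n → ℝ := fun j z => ∫ y, ρ (z - y) * U (φ j) y
  let L : Amb n → ℝ := fun z => ⟪G 0, (hρm z).toLp⟫
  have hmL : ∀ z, Tendsto (fun j => m j z) atTop (𝓝 (L z)) := by
    intro z
    refine (hG 0 (hρm z).toLp).congr fun j => ?_
    rw [L2.inner_def]
    refine integral_congr_ae ?_
    filter_upwards [(hm (φ j)).coeFn_toLp, (hρm z).coeFn_toLp] with y hy1 hy2
    rw [hy1, hy2]
    simp
  set B := (∫ y, ρ y ^ 2) + C with hB
  have hmB : ∀ j z, |m j z| ≤ B := by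
    intro j z
    have hi1 : Integrable fun y => ρ (z - y) ^ 2 := (hρm z).integrable_sq
    have hi2 : Integrable fun y => U (φ j) y ^ 2 := (hm (φ j)).integrable_sq
    calc |m j z| ≤ ∫ y, (ρ (z - y) ^ 2 + U (φ j) y ^ 2) := by
          rw [← Real.norm_eq_abs]
          refine norm_integral_le_of_norm_le (hi1.add hi2) (Eventually.of_forall fun y => ?_)
          rw [Real.norm_eq_abs, abs_mul]
          nlinarith [sq_nonneg (|ρ (z - y)| - |U (φ j) y|), sq_abs (ρ (z - y)),
            sq_abs (U (φ j) y), sq_nonneg (ρ (z - y)), sq_nonneg (U (φ j) y)]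
      _ ≤ B := by
          rw [integral_add hi1 hi2, integral_sub_left_eq_self (fun y => ρ y ^ 2) volume z]
          linarith [h2 (φ j)]
  have hm0 : ∀ j, ∀ z ∉ Metric.closedBall (0 : Amb n) (R + δ), m j z = 0 := by
    intro j z hz
    refine integral_eq_zero_of_ae (Eventually.of_forall fun y => ?_)
    simp only [Metric.mem_closedBall, dist_zero_right, not_le] at hz
    by_cases hy : ‖y‖ ≤ R
    · have := norm_sub_norm_le z y
      simp [hρs (z - y) (by linarith)]
    · simp [hs (φ j) y (by simpa using hy)]
  have hmm : ∀ j, AEStronglyMeasurable (m j) volume := by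
    intro j
    have h1 : StronglyMeasurable fun p : Amb n × Amb n => ρ (p.1 - p.2) * U (φ j) p.2 := by
      have := (hU (φ j)).continuous
      exact Continuous.stronglyMeasurable (by fun_prop)
    exact (h1.integral_prod_right' (ν := (volume : Measure (Amb n)))).aestronglyMeasurable
  have hLm : AEStronglyMeasurable L volume :=
    aestronglyMeasurable_of_tendsto_ae atTop hmm (Eventually.of_forall hmL)
  have hLB : ∀ z, |L z| ≤ B := fun z => le_of_tendsto (hmL z).abs
    (Eventually.of_forall fun j => hmB j z)
  have hL0 : ∀ z ∉ Metric.closedBall (0 : Amb n) (R + δ), L z = 0 := fun z hz =>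
    tendsto_nhds_unique (hmL z) (by simp [hm0 _ z hz])
  let bd : Amb n → ℝ := (Metric.closedBall (0 : Amb n) (R + δ)).indicator fun _ => B
  have hbd : Integrable bd := (integrable_indicator_iff Metric.isClosed_closedBall.measurableSet).2
    (integrableOn_const (isCompact_closedBall _ _).measure_lt_top.ne)
  have hmb : ∀ j z, ‖m j z‖ ≤ bd z := by
    intro j z
    by_cases hz : z ∈ Metric.closedBall (0 : Amb n) (R + δ)
    · simpa [bd, Set.indicator_of_mem hz] using hmB j z
    · simp [bd, Set.indicator_of_notMem hz, hm0 j z hz]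
  have hLb : ∀ z, ‖L z‖ ≤ bd z := by
    intro z
    by_cases hz : z ∈ Metric.closedBall (0 : Amb n) (R + δ)
    · simpa [bd, Set.indicator_of_mem hz] using hLB z
    · simp [bd, Set.indicator_of_notMem hz, hL0 z hz]
  have hmi : ∀ j, Integrable (m j) := fun j => hbd.mono' (hmm j) (Eventually.of_forall (hmb j))
  have hLi : Integrable L := hbd.mono' hLm (Eventually.of_forall hLb)
  have hlim : Tendsto (fun j => ∫ z, |m j z - L z|) atTop (𝓝 0) := by
    have := tendsto_integral_of_dominated_convergence (F := fun j z => |m j z - L z|)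
      (f := fun _ => (0 : ℝ)) (fun z => bd z + bd z) (fun j => ((hmm j).sub hLm).norm)
      (hbd.add hbd) (fun j => Eventually.of_forall fun z => ?_) (Eventually.of_forall fun z => ?_)
    · simpa using this
    · rw [norm_abs_eq_norm]
      exact (norm_sub_le _ _).trans (add_le_add (hmb j z) (hLb z))
    · simpa using ((hmL z).sub_const (L z)).abs
  obtain ⟨N, hN⟩ := eventually_atTop.1 (hlim.eventually (ge_mem_nhds (show 0 < ε / 4 by linarith)))
  refine ⟨N, fun j hj k hk => ?_⟩
  have hmoll : ∀ j, ∫ z, |m j z - U (φ j) z| ≤ ε / 4 := fun j =>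
    (integral_abs_mollify_sub_le (hU (φ j)) (hs (φ j)) hδ).trans
      ((mul_le_mul_of_nonneg_left (h1 (φ j)) hδ.le).trans hδε)
  have i1 : ∀ j, Integrable fun z => |m j z - U (φ j) z| := fun j => ((hmi j).sub (hUi _)).abs
  have i2 : ∀ j, Integrable fun z => |m j z - L z| := fun j => ((hmi j).sub hLi).abs
  have i3 : ∀ j, Integrable fun z => |m j z - U (φ j) z| + |m j z - L z| := fun j =>
    (i1 j).add (i2 j)
  calc ∫ z, |U (φ j) z - U (φ k) z|
      ≤ ∫ z, ((|m j z - U (φ j) z| + |m j z - L z|) +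
          (|m k z - U (φ k) z| + |m k z - L z|)) := by
        refine integral_mono ((hUi _).sub (hUi _)).abs ((i3 j).add (i3 k)) fun z => ?_
        have e : U (φ j) z - U (φ k) z = -(m j z - U (φ j) z) + (m j z - L z) +
          ((m k z - U (φ k) z) - (m k z - L z)) := by ring
        simp only
        rw [e]
        refine (abs_add_le _ _).trans (add_le_add ((abs_add_le _ _).trans ?_) (abs_sub _ _))
        rw [abs_neg]
    _ = (∫ z, |m j z - U (φ j) z|) + (∫ z, |m j z - L z|) +
          ((∫ z, |m k z - U (φ k) z|) + ∫ z, |m k z - L z|) := by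
        rw [integral_add (i3 j) (i3 k), integral_add (i1 j) (i2 j),
          integral_add (i1 k) (i2 k)]
    _ ≤ ε := by linarith [hmoll j, hmoll k, hN j hj, hN k hk]

/-! ### Almost everywhere convergence on the sphere -/

/-- The derivative of the radial extension is homogeneous of degree `-1`. -/
theorem norm_fderiv_radialExt {n : ℕ} {u : Sph n → ℝ} (hu : ContMDiff (𝓡 n) 𝓘(ℝ, ℝ) ∞ u)
    {z : Amb n} (hz : z ≠ 0) :
    ‖fderiv ℝ (radialExt u) z‖ = ‖z‖⁻¹ * radialExt (fun x => ‖sphereGrad u x‖) z := by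
  have hc : 0 < ‖z‖⁻¹ := inv_pos.2 (norm_pos_iff.2 hz)
  have hcz : ‖z‖⁻¹ • z ≠ 0 := smul_ne_zero hc.ne' hz
  have h1 : HasFDerivAt (radialExt u) (fderiv ℝ (radialExt u) (‖z‖⁻¹ • z)) (‖z‖⁻¹ • z) :=
    ((contDiffAt_radialExt hu hcz).differentiableAt (by simp)).hasFDerivAt
  have h2 : HasFDerivAt (radialExt u) _ z :=
    (h1.comp z ((hasFDerivAt_id z).const_smul ‖z‖⁻¹)).congr_of_eventuallyEq
      (Eventually.of_forall fun w => (radialExt_pos_smul u hc w).symm)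
  rw [h2.fderiv, radialExt_of_ne _ hz]
  simp only [ContinuousLinearMap.comp_smul, ContinuousLinearMap.comp_id, norm_smul, norm_inv,
    norm_norm]
  congr 1
  exact ((InnerProductSpace.toDual ℝ (Amb n)).symm.norm_map _).symm

theorem integrable_radial_mul {n : ℕ} {g : ℝ → ℝ} (hg : Continuous g) (h1 : ∀ r < 1, g r = 0)
    (h3 : ∀ r, 3 < r → g r = 0) {F : Amb n → ℝ} (hF : ∀ z, z ≠ 0 → ContinuousAt F z) :
    Integrable fun z => F z * g ‖z‖ := by
  refine Continuous.integrable_of_hasCompactSupport ?_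
    (HasCompactSupport.intro (isCompact_closedBall (0 : Amb n) 3) fun z hz => ?_)
  · refine continuous_iff_continuousAt.2 fun z => ?_
    by_cases hz : z = 0
    · refine (continuousAt_const (y := (0 : ℝ))).congr ?_
      have : ∀ᶠ w : Amb n in 𝓝 z, ‖w‖ < 1 := by
        refine continuous_norm.continuousAt.eventually_lt continuousAt_const ?_
        simp [hz]
      filter_upwards [this] with w hw
      simp [h1 _ hw]
    · exact (hF z hz).mul (hg.comp continuous_norm).continuousAt
  · rw [h3 _ (by simpa using hz), mul_zero]

theorem deriv_radialBump_eq_zero_of_lt {r : ℝ} (h : r < 1) : deriv radialBump r = 0 := by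
  have : (radialBump : ℝ → ℝ) =ᶠ[𝓝 r] fun _ => 0 := by
    filter_upwards [gt_mem_nhds h] with s hs
    exact radialBump_eq_zero_of_lt hs
  rw [this.deriv_eq, deriv_const]

theorem deriv_radialBump_eq_zero_of_gt {r : ℝ} (h : 3 < r) : deriv radialBump r = 0 := by
  have : (radialBump : ℝ → ℝ) =ᶠ[𝓝 r] fun _ => 0 := by
    filter_upwards [lt_mem_nhds h] with s hs
    exact radialBump_eq_zero_of_gt hs
  rw [this.deriv_eq, deriv_const]

theorem continuousAt_radialExt {n : ℕ} {u : Sph n → ℝ} (hu : Continuous u) {z : Amb n}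
    (hz : z ≠ 0) : ContinuousAt (radialExt u) z := by
  let N : {z : Amb n // z ≠ 0} → Sph n := fun z =>
    ⟨‖(z : Amb n)‖⁻¹ • (z : Amb n), by
      simp [norm_smul, inv_mul_cancel₀ (norm_ne_zero_iff.mpr z.2)]⟩
  have hN : Continuous N := by
    refine Continuous.subtype_mk ?_ _
    exact (continuous_subtype_val.norm.inv₀ fun z => norm_ne_zero_iff.2 z.2).smul
      continuous_subtype_val
  have h1 : ContinuousOn (radialExt u) {z : Amb n | z ≠ 0} := by
    rw [continuousOn_iff_continuous_domRestrict]
    refine (hu.comp hN).congr fun z => ?_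
    exact (radialExt_of_ne u z.2).symm
  exact h1.continuousAt (isOpen_ne.mem_nhds hz)

/-- The function `η(|z|) u(z / |z|)` on `ℝⁿ⁺¹` inherits the `L²` and the `W^{1,1}` bounds
of `u`, with constants that depend on the dimension and on `η` only. -/
theorem exists_integral_radialBump_bounds (n : ℕ) :
    ∃ K : ℝ, 0 ≤ K ∧ ∀ u : Sph n → ℝ, ContMDiff (𝓡 n) 𝓘(ℝ, ℝ) ∞ u →
      ∫ z : Amb n, (radialBump ‖z‖ • radialExt u z) ^ 2 ≤ K * ∫ x, u x ^ 2 ∂(roundVolume n) ∧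
      ∫ z : Amb n, ‖fderiv ℝ (fun z => radialBump ‖z‖ • radialExt u z) z‖ ≤
        K * ((∫ x, |u x| ∂(roundVolume n)) + ∫ x, ‖sphereGrad u x‖ ∂(roundVolume n)) := by
  have hdc : Continuous (deriv radialBump) :=
    (radialBump.contDiff (n := 1)).continuous_deriv (by simp)
  set c1 := ∫ r : Set.Ioi (0 : ℝ), radialBump r ^ 2 ∂(Measure.volumeIoiPow n) with hc1
  set c2 := ∫ r : Set.Ioi (0 : ℝ), |deriv radialBump r| ∂(Measure.volumeIoiPow n) with hc2
  set c3 := ∫ r : Set.Ioi (0 : ℝ), radialBump r ∂(Measure.volumeIoiPow n) with hc3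
  have h1 : 0 ≤ c1 := integral_nonneg fun _ => sq_nonneg _
  have h2 : 0 ≤ c2 := integral_nonneg fun _ => abs_nonneg _
  have h3 : 0 ≤ c3 := integral_nonneg fun _ => radialBump.nonneg
  refine ⟨c1 + c2 + c3, by positivity, fun u hu => ⟨?_, ?_⟩⟩
  · have h0 : 0 ≤ ∫ x, u x ^ 2 ∂(roundVolume n) := integral_nonneg fun _ => sq_nonneg _
    have e : ∫ z : Amb n, (radialBump ‖z‖ • radialExt u z) ^ 2 =
        ∫ z : Amb n, radialExt (fun x => u x ^ 2) z * radialBump ‖z‖ ^ 2 := by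
      refine integral_congr_ae ?_
      filter_upwards [ae_ne_zero_amb] with z hz
      rw [radialExt_comp u (fun t => t ^ 2) hz, smul_eq_mul]
      ring
    rw [e, integral_radial_mul_radialExt (fun r => radialBump r ^ 2)]
    nlinarith
  · have h01 : 0 ≤ ∫ x, |u x| ∂(roundVolume n) := integral_nonneg fun _ => abs_nonneg _
    have h02 : 0 ≤ ∫ x, ‖sphereGrad u x‖ ∂(roundVolume n) := integral_nonneg fun _ => norm_nonneg _
    have hi1 : Integrable fun z : Amb n => radialExt (fun x => |u x|) z * |deriv radialBump ‖z‖| :=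
      integrable_radial_mul (g := fun r => |deriv radialBump r|) hdc.abs
        (fun r hr => by simp [deriv_radialBump_eq_zero_of_lt hr])
        (fun r hr => by simp [deriv_radialBump_eq_zero_of_gt hr])
        fun z hz => continuousAt_radialExt hu.continuous.abs hz
    have hi2 : Integrable fun z : Amb n =>
        radialExt (fun x => ‖sphereGrad u x‖) z * radialBump ‖z‖ :=
      integrable_radial_mul radialBump.continuous (fun r => radialBump_eq_zero_of_lt)
        (fun r => radialBump_eq_zero_of_gt)
        fun z hz => continuousAt_radialExt (continuous_sphereGrad hu).norm hz
    have hC1 : ContDiff ℝ 1 (fun z : Amb n => radialBump ‖z‖ • radialExt u z) :=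
      contDiff_radialBump_smul fun z hz => (contDiffAt_radialExt hu hz).of_le (by simp)
    have hi0 := ((hC1.continuous_fderiv (by simp)).integrable_of_hasCompactSupport
      ((hasCompactSupport_radialBump_smul (radialExt u)).fderiv ℝ) (μ := volume)).norm
    have hpt : ∀ z : Amb n, z ≠ 0 →
        ‖fderiv ℝ (fun z => radialBump ‖z‖ • radialExt u z) z‖ ≤
          radialExt (fun x => |u x|) z * |deriv radialBump ‖z‖| +
            radialExt (fun x => ‖sphereGrad u x‖) z * radialBump ‖z‖ := by
      intro z hz
      have hr : HasFDerivAt (fun w : Amb n => radialBump ‖w‖)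
          (deriv radialBump ‖z‖ • ‖z‖⁻¹ • innerSL ℝ z) z :=
        ((radialBump.contDiff (n := 1)).differentiable (by simp)
          ‖z‖).hasDerivAt.comp_hasFDerivAt z (hasFDerivAt_norm_amb hz)
      have hd := hr.fun_smul
        ((contDiffAt_radialExt hu hz).differentiableAt (by simp)).hasFDerivAt
      have hnz : 0 < ‖z‖ := norm_pos_iff.2 hz
      rw [hd.fderiv]
      refine (norm_add_le _ _).trans ((add_le_add ?_ (le_of_eq ?_)).trans_eq (add_comm _ _))
      · rw [norm_smul, norm_fderiv_radialExt hu hz, Real.norm_of_nonneg radialBump.nonneg]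
        have hE : 0 ≤ radialExt (fun x => ‖sphereGrad u x‖) z := by
          rw [radialExt_of_ne _ hz]
          exact norm_nonneg _
        rcases lt_or_ge ‖z‖ 1 with h | h
        · simp [radialBump_eq_zero_of_lt h]
        · rw [mul_comm]
          exact mul_le_mul_of_nonneg_right
            (mul_le_of_le_one_left hE (inv_le_one_of_one_le₀ h)) radialBump.nonneg
      · rw [ContinuousLinearMap.norm_smulRight_apply, norm_smul, norm_smul, innerSL_apply_norm,
          norm_inv, norm_norm, inv_mul_cancel₀ hnz.ne', mul_one, Real.norm_eq_abs, Real.norm_eq_abs,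
          radialExt_comp u (fun t => |t|) hz, mul_comm]
    refine (integral_mono_ae hi0 (hi1.add hi2) (ae_ne_zero_amb.mono hpt)).trans ?_
    change ∫ z : Amb n, radialExt (fun x => |u x|) z * |deriv radialBump ‖z‖| +
      radialExt (fun x => ‖sphereGrad u x‖) z * radialBump ‖z‖ ≤ _
    rw [integral_add hi1 hi2, integral_radial_mul_radialExt (fun r => |deriv radialBump r|),
      integral_radial_mul_radialExt]
    nlinarith [mul_nonneg h01 h1, mul_nonneg h01 h3, mul_nonneg h02 h1, mul_nonneg h02 h2]

/-- Smooth functions on the sphere that are bounded in `L²` and have gradients bounded in `L¹`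
converge almost everywhere along a subsequence. -/
theorem exists_subseq_tendsto_ae {n : ℕ} {u : ℕ → Sph n → ℝ}
    (hu : ∀ j, ContMDiff (𝓡 n) 𝓘(ℝ, ℝ) ∞ (u j)) {C : ℝ}
    (h2 : ∀ j, ∫ x, u j x ^ 2 ∂(roundVolume n) ≤ C)
    (h1 : ∀ j, ∫ x, ‖sphereGrad (u j) x‖ ∂(roundVolume n) ≤ C) :
    ∃ (φ : ℕ → ℕ) (v : Sph n → ℝ), StrictMono φ ∧ StronglyMeasurable v ∧
      ∀ᵐ x ∂(roundVolume n), Tendsto (fun j => u (φ j) x) atTop (𝓝 (v x)) := by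
  obtain ⟨K, hK, hKu⟩ := exists_integral_radialBump_bounds n
  have hi : ∀ j, Integrable (u j) (roundVolume n) := fun j =>
    integrable_of_continuous_sph (hu j).continuous
  have habs : ∀ j, ∫ x, |u j x| ∂(roundVolume n) ≤ (roundVolume n).real Set.univ + C := by
    intro j
    have hi2 : Integrable (fun x => u j x ^ 2) (roundVolume n) :=
      integrable_of_continuous_sph ((hu j).continuous.pow 2)
    have : ∫ x, |u j x| ∂(roundVolume n) ≤ ∫ x, (1 + u j x ^ 2) ∂(roundVolume n) := by
      refine integral_mono (hi j).abs ((integrable_const _).add hi2) fun x => ?_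
      simp only
      nlinarith [sq_nonneg (|u j x| - 1), sq_abs (u j x)]
    rw [integral_add (integrable_const _) hi2, integral_const, smul_eq_mul, mul_one] at this
    linarith [h2 j]
  set m0 := (roundVolume n).real Set.univ
  have hm0 : 0 ≤ m0 := measureReal_nonneg
  obtain ⟨φ, hφ, hcau⟩ := exists_subseq_cauchy_integral_abs_sub
    (U := fun j z => radialBump ‖z‖ • radialExt (u j) z) (R := 3) (C := K * (m0 + C + C))
    (fun j => contDiff_radialBump_smul fun z hz =>
      (contDiffAt_radialExt (hu j) hz).of_le (by simp))
    (fun j z hz => radialBump_smul_eq_zero _ hz)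
    (fun j => by
      have hC : 0 ≤ C := (integral_nonneg fun _ => sq_nonneg _).trans (h2 j)
      exact ((hKu _ (hu j)).1).trans (mul_le_mul_of_nonneg_left (by linarith [h2 j]) hK))
    (fun j => ((hKu _ (hu j)).2).trans
      (mul_le_mul_of_nonneg_left (add_le_add (habs j) (h1 j)) hK))
  set c := ∫ r : Set.Ioi (0 : ℝ), radialBump r ∂(Measure.volumeIoiPow n)
  have hcpos : 0 < c := integral_volumeIoiPow_pos radialBump.continuous
    (fun _ => radialBump.nonneg) (by
      have : radialBump 2 = 1 := radialBump.one_of_mem_closedBall (by simp [radialBump])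
      simp [this]) fun r => radialBump_eq_zero_of_gt
  -- By polar coordinates, distances in `L¹(ℝⁿ⁺¹)` are multiples of distances in `L¹(𝕊ⁿ)`.
  have heq : ∀ j k, ∫ z : Amb n, |radialBump ‖z‖ • radialExt (u j) z -
      radialBump ‖z‖ • radialExt (u k) z| = (∫ x, |u j x - u k x| ∂(roundVolume n)) * c := by
    intro j k
    rw [← integral_radial_mul_radialExt]
    refine integral_congr_ae ?_
    filter_upwards [ae_ne_zero_amb] with z hz
    rw [← smul_sub, smul_eq_mul, abs_mul, abs_of_nonneg radialBump.nonneg, mul_comm]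
    simp only [radialExt_of_ne _ hz]
  let F : ℕ → Lp ℝ 1 (roundVolume n) := fun j => (hi (φ j)).toL1
  have hF : CauchySeq F := by
    refine Metric.cauchySeq_iff.2 fun ε hε => ?_
    obtain ⟨N, hN⟩ := hcau (ε / 2 * c) (by positivity)
    refine ⟨N, fun j hj k hk => ?_⟩
    have h := hN j hj k hk
    rw [heq] at h
    have h3 := le_of_mul_le_mul_right h hcpos
    rw [L1.dist_eq_integral_dist]
    refine lt_of_le_of_lt ?_ (lt_of_le_of_lt h3 (by linarith))
    refine le_of_eq (integral_congr_ae ?_)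
    filter_upwards [(hi (φ j)).coeFn_toL1, (hi (φ k)).coeFn_toL1] with x hx1 hx2
    simp only [F]
    rw [hx1, hx2, Real.dist_eq]
  obtain ⟨v, hv⟩ := cauchySeq_tendsto_of_complete hF
  obtain ⟨ψ, hψ, hae⟩ := (tendstoInMeasure_of_tendsto_Lp hv).exists_seq_tendsto_ae
  refine ⟨φ ∘ ψ, v, hφ.comp hψ, Lp.stronglyMeasurable v, ?_⟩
  have hall : ∀ᵐ x ∂(roundVolume n), ∀ j, F j x = u (φ j) x :=
    ae_all_iff.2 fun j => (hi (φ j)).coeFn_toL1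
  filter_upwards [hae, hall] with x hx1 hx2
  exact hx1.congr fun j => hx2 _

/-! ### Strong and weak convergence in Lebesgue spaces -/

/-- Vitali's theorem: almost everywhere convergent sequences bounded in `L^P` converge in `L^p` for
`p < P`. -/
theorem tendsto_eLpNorm_of_tendsto_ae_of_eLpNorm_le {α : Type*} [MeasurableSpace α]
    {μ : Measure α} [IsFiniteMeasure μ] {p P M : ℝ≥0∞} (hp : 1 ≤ p) (hpP : p < P) (hM : M ≠ ⊤)
    {v : ℕ → α → ℝ} {w : α → ℝ} (hv : ∀ j, AEStronglyMeasurable (v j) μ)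
    (hvw : ∀ᵐ x ∂μ, Tendsto (fun j => v j x) atTop (𝓝 (w x))) (hb : ∀ j, eLpNorm (v j) P μ ≤ M) :
    MemLp w p μ ∧ Tendsto (fun j => eLpNorm (v j - w) p μ) atTop (𝓝 0) := by
  have hptop : p ≠ ⊤ := (hpP.trans_le le_top).ne
  have hp0 : 0 < p.toReal := ENNReal.toReal_pos (zero_lt_one.trans_le hp).ne' hptop
  have hw : MemLp w P μ := by
    refine ⟨aestronglyMeasurable_of_tendsto_ae atTop hv hvw, ?_⟩
    refine lt_of_le_of_lt (Lp.eLpNorm_lim_le_liminf_eLpNorm hv w hvw) ?_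
    refine lt_of_le_of_lt ?_ hM.lt_top
    exact (liminf_le_liminf (Eventually.of_forall hb)).trans (by simp)
  refine ⟨hw.mono_exponent hpP.le, ?_⟩
  refine tendsto_Lp_finite_of_tendsto_ae hp hptop hv (hw.mono_exponent hpP.le) ?_ hvw
  set θ : ℝ := 1 / p.toReal - 1 / P.toReal with hθ
  have hθ0 : 0 < θ := by
    rcases eq_or_ne P ⊤ with h | h
    · simp [hθ, h, hp0]
    · have := ENNReal.toReal_strict_mono h hpP
      exact sub_pos.2 (one_div_lt_one_div_of_lt hp0 this)
  -- Uniform integrability: by Hölder's inequality `‖v_j 1_s‖_p ≤ M μ(s)^θ`.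
  intro ε hε
  have hM1 : 0 < M.toReal + 1 := by positivity
  refine ⟨(ε / (M.toReal + 1)) ^ (1 / θ), by positivity, fun j s hs hμs => ?_⟩
  rw [eLpNorm_indicator_eq_eLpNorm_restrict hs]
  refine (eLpNorm_le_eLpNorm_mul_rpow_measure_univ hpP.le (hv j).restrict).trans ?_
  have h1 : eLpNorm (v j) P (μ.restrict s) ≤ ENNReal.ofReal (M.toReal + 1) := by
    refine (eLpNorm_mono_measure _ Measure.restrict_le_self).trans ((hb j).trans ?_)
    rw [← ENNReal.ofReal_toReal hM]
    exact ENNReal.ofReal_le_ofReal (by simp)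
  have h2 : (μ.restrict s Set.univ) ^ (1 / p.toReal - 1 / P.toReal) ≤
      ENNReal.ofReal (ε / (M.toReal + 1)) := by
    rw [← hθ, Measure.restrict_apply_univ]
    refine (ENNReal.rpow_le_rpow hμs hθ0.le).trans (le_of_eq ?_)
    rw [ENNReal.ofReal_rpow_of_nonneg (by positivity) hθ0.le, ← Real.rpow_mul (by positivity),
      one_div_mul_cancel hθ0.ne', Real.rpow_one]
  refine (mul_le_mul' h1 h2).trans (le_of_eq ?_)
  rw [← ENNReal.ofReal_mul hM1.le, mul_div_cancel₀ _ hM1.ne']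

/-- A bounded bilinear map applied to a strongly and a weakly convergent sequence. -/
theorem tendsto_bilinear_of_tendsto_of_weak {E H : Type*} [NormedAddCommGroup E]
    [NormedSpace ℝ E] [NormedAddCommGroup H] [InnerProductSpace ℝ H] [CompleteSpace H]
    (T : E →L[ℝ] H →L[ℝ] ℝ) {a : ℕ → E} {a' : E} (ha : Tendsto a atTop (𝓝 a')) {F : ℕ → H} {G : H}
    {C : ℝ} (hF : ∀ j, ‖F j‖ ≤ C) (hG : ∀ y, Tendsto (fun j => ⟪F j, y⟫) atTop (𝓝 ⟪G, y⟫)) :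
    Tendsto (fun j => T (a j) (F j)) atTop (𝓝 (T a' G)) := by
  -- `T a_j F_j = T (a_j - a') F_j + T a' F_j`
  have h1 : Tendsto (fun j => T (a j - a') (F j)) atTop (𝓝 0) := by
    have h3 : Tendsto (fun j => ‖T‖ * ‖a j - a'‖ * C) atTop (𝓝 0) := by
      have := ((tendsto_iff_norm_sub_tendsto_zero.1 ha).const_mul ‖T‖).mul_const C
      simpa using this
    refine squeeze_zero_norm (fun j => ?_) h3
    exact (T.le_opNorm₂ _ _).trans (mul_le_mul_of_nonneg_left (hF j) (by positivity))
  have h2 : Tendsto (fun j => T a' (F j)) atTop (𝓝 (T a' G)) := by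
    have e : ∀ z, ⟪z, (InnerProductSpace.toDual ℝ H).symm (T a')⟫ = T a' z := fun z => by
      rw [real_inner_comm, InnerProductSpace.toDual_symm_apply]
    simpa only [e] using hG ((InnerProductSpace.toDual ℝ H).symm (T a'))
  have h3 := h1.add h2
  rw [zero_add] at h3
  refine h3.congr fun j => ?_
  simp

/-! ### Weak convergence in Sobolev spaces -/

/-- Weak convergence is convergence of the values of all continuous functionals. -/
theorem tendsto_toWeakSpace_iff {E : Type*} [NormedAddCommGroup E] [NormedSpace ℝ E] {w : ℕ → E}
    {w' : E} : Tendsto (fun j => toWeakSpace ℝ E (w j)) atTop (𝓝 (toWeakSpace ℝ E w')) ↔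
      ∀ ℓ : StrongDual ℝ E, Tendsto (fun j => ℓ (w j)) atTop (𝓝 (ℓ w')) := by
  have hI : IsInducing (fun (x : WeakSpace ℝ E) (ℓ : StrongDual ℝ E) =>
      ℓ ((toWeakSpace ℝ E).symm x)) := ⟨rfl⟩
  rw [hI.tendsto_nhds_iff, tendsto_pi_nhds]
  rfl

/-- In a subspace of a product, strong convergence of the first and weak convergence of the second
component imply weak convergence. -/
theorem tendsto_toWeakSpace_submodule_prod {E E' : Type*} [NormedAddCommGroup E] [NormedSpace ℝ E]
    [NormedAddCommGroup E'] [NormedSpace ℝ E'] {S : Submodule ℝ (E × E')} {w : ℕ → S} {w' : S}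
    (h1 : Tendsto (fun j => (w j).1.1) atTop (𝓝 w'.1.1))
    (h2 : ∀ ℓ : StrongDual ℝ E', Tendsto (fun j => ℓ (w j).1.2) atTop (𝓝 (ℓ w'.1.2))) :
    Tendsto (fun j => toWeakSpace ℝ S (w j)) atTop (𝓝 (toWeakSpace ℝ S w')) := by
  refine tendsto_toWeakSpace_iff.2 fun ℓ => ?_
  -- By the Hahn-Banach theorem functionals on the subspace are restrictions.
  obtain ⟨g, hg, -⟩ := exists_extension_norm_eq S ℓ
  let g1 : StrongDual ℝ E := g.comp (ContinuousLinearMap.inl ℝ E E')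
  let g2 : StrongDual ℝ E' := g.comp (ContinuousLinearMap.inr ℝ E E')
  have hsplit : ∀ p : S, ℓ p = g1 p.1.1 + g2 p.1.2 := by
    intro p
    rw [← hg p]
    simp [g1, g2, ← map_add]
  simp_rw [hsplit]
  exact ((g1.continuous.tendsto _).comp h1).add (h2 g2)

/-- Integration against a function in the dual Lebesgue space passes to weak limits. -/
theorem tendsto_integral_bilinear {α : Type*} [MeasurableSpace α] {μ : Measure α}
    {E E' : Type*} [NormedAddCommGroup E] [NormedSpace ℝ E] [NormedAddCommGroup E']
    [NormedSpace ℝ E'] {q : ℝ≥0∞} [hq : Fact (1 ≤ q)] (B : E →L[ℝ] E' →L[ℝ] ℝ)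
    {X : ℕ → Lp E q μ} {X' : Lp E q μ}
    (h : ∀ ℓ : StrongDual ℝ (Lp E q μ), Tendsto (fun j => ℓ (X j)) atTop (𝓝 (ℓ X')))
    {Y : α → E'} (hY : ∀ p, 1 ≤ p → MemLp Y p μ) :
    Tendsto (fun j => ∫ x, B (X j x) (Y x) ∂μ) atTop (𝓝 (∫ x, B (X' x) (Y x) ∂μ)) := by
  set q' : ℝ≥0∞ := (1 - q⁻¹)⁻¹ with hq'
  have h1q : q⁻¹ ≤ 1 := ENNReal.inv_le_one.2 hq.out
  have : ENNReal.HolderTriple q q' 1 := ⟨by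
    rw [hq', inv_inv, inv_one, add_tsub_cancel_of_le h1q]⟩
  have hf : Fact (1 ≤ q') := ⟨by rw [hq', ENNReal.one_le_inv]; exact tsub_le_self⟩
  have hYm := hY q' hf.out
  have key : ∀ Z : Lp E q μ, B.lpPairing μ q q' Z hYm.toLp = ∫ x, B (Z x) (Y x) ∂μ := by
    intro Z
    rw [ContinuousLinearMap.lpPairing_eq_integral]
    refine integral_congr_ae ?_
    filter_upwards [hYm.coeFn_toLp] with x hx
    rw [hx]
  have := h ((B.lpPairing μ q q').flip hYm.toLp)
  simpa only [ContinuousLinearMap.flip_apply, key] using this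

theorem memLp_of_continuous_sph {n : ℕ} {G : Type*} [NormedAddCommGroup G]
    [SecondCountableTopology G] {F : Sph n → G} (hF : Continuous F) (p : ℝ≥0∞) :
    MemLp F p (roundVolume n) := by
  obtain ⟨C, hC⟩ := isCompact_univ.exists_bound_of_continuousOn hF.continuousOn
  borelize G
  exact MemLp.of_bound hF.aestronglyMeasurable C
    (Eventually.of_forall fun x => hC x (Set.mem_univ x))

/-- Weak gradients pass to weak limits in `L^q`. -/
theorem isWeakGrad_of_tendsto {n : ℕ} {q : ℝ≥0∞} [Fact (1 ≤ q)]
    {u : ℕ → Lp ℝ q (roundVolume n)} {u' : Lp ℝ q (roundVolume n)}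
    {X : ℕ → Lp (Amb n) q (roundVolume n)} {X' : Lp (Amb n) q (roundVolume n)}
    (hg : ∀ j, IsWeakGrad (u j) (X j)) (hu : Tendsto u atTop (𝓝 u'))
    (hX : ∀ ℓ : StrongDual ℝ (Lp (Amb n) q (roundVolume n)),
      Tendsto (fun j => ℓ (X j)) atTop (𝓝 (ℓ X'))) : IsWeakGrad u' X' := by
  refine ⟨?_, fun Y hY => ?_⟩
  · -- Testing with the bounded field `sign ⟨X', x⟩ x` shows that `⟨X', x⟩` has integral norm zero.
    have hmX : Measurable X' := (Lp.stronglyMeasurable X').measurable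
    have hm : Measurable fun x : Sph n => ⟪X' x, (x : Amb n)⟫ :=
      hmX.inner measurable_subtype_coe
    let Y : Sph n → Amb n := fun x => Real.sign ⟪X' x, (x : Amb n)⟫ • (x : Amb n)
    have hsm : Measurable Real.sign := by
      refine Measurable.ite measurableSet_Iio measurable_const ?_
      exact Measurable.ite measurableSet_Ioi measurable_const measurable_const
    have hYm : Measurable Y := (hsm.comp hm).smul measurable_subtype_coe
    have hYb : ∀ x, ‖Y x‖ ≤ 1 := by
      intro x
      simp only [Y, norm_smul, norm_coe_sph, mul_one]
      rcases Real.sign_apply_eq ⟪X' x, (x : Amb n)⟫ with h | h | h <;> rw [h] <;> simp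
    have hYp : ∀ p, 1 ≤ p → MemLp Y p (roundVolume n) := fun p _ =>
      MemLp.of_bound hYm.aestronglyMeasurable 1 (Eventually.of_forall hYb)
    have h1 := tendsto_integral_bilinear (innerSL ℝ) hX hYp
    have h2 : ∀ j, ∫ x, innerSL ℝ (X j x) (Y x) ∂(roundVolume n) = 0 := by
      intro j
      refine integral_eq_zero_of_ae ?_
      filter_upwards [(hg j).1] with x hx
      simp [Y, hx]
    simp only [h2] at h1
    have h3 : ∫ x, |⟪X' x, (x : Amb n)⟫| ∂(roundVolume n) = 0 := by
      rw [← tendsto_nhds_unique h1 tendsto_const_nhds]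
      refine integral_congr_ae (Eventually.of_forall fun x => ?_)
      simp only [Y]
      rw [innerSL_apply_apply, real_inner_smul_right]
      rcases lt_trichotomy ⟪X' x, (x : Amb n)⟫ 0 with h | h | h
      · rw [abs_of_neg h, Real.sign_of_neg h, neg_one_mul]
      · simp [h]
      · rw [abs_of_pos h, Real.sign_of_pos h, one_mul]
    have hXi : Integrable X' (roundVolume n) := (Lp.memLp X').integrable Fact.out
    have hi : Integrable (fun x : Sph n => ⟪X' x, (x : Amb n)⟫) (roundVolume n) := by
      refine hXi.norm.mono' hm.aestronglyMeasurable (Eventually.of_forall fun x => ?_)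
      refine (norm_inner_le_norm _ _).trans ?_
      rw [norm_coe_sph, mul_one]
    filter_upwards [(integral_eq_zero_iff_of_nonneg (fun _ => abs_nonneg _) hi.abs).1 h3] with x hx
    simpa using hx
  · have hYc : Continuous fun x : Sph n => Y x := hY.1.continuous.comp continuous_subtype_val
    have h1 := tendsto_integral_bilinear (innerSL ℝ) hX
      (fun p _ => memLp_of_continuous_sph hYc p)
    have h2 := tendsto_integral_bilinear (ContinuousLinearMap.mul ℝ ℝ)
      (fun ℓ => (ℓ.continuous.tendsto _).comp hu)
      (fun p _ => memLp_of_continuous_sph (continuous_sphereDiv hY) p)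
    refine tendsto_nhds_unique h1 (h2.neg.congr fun j => ?_)
    exact ((hg j).2 Y hY).symm

/-! ### Convergence of the conformal factors -/

/-- A bound of `e^{γf}` in `L^P` for `Pγ ≤ n`, in terms of the volume. -/
theorem eLpNorm_exp_mul_le {n : ℕ} {V : ℝ} (hV : 0 < V) {f : Sph n → ℝ} (hf : Admissible n V f)
    {P γ : ℝ} (hP : 0 < P) (hγ : 0 ≤ γ) (hPγ : P * γ ≤ n) :
    eLpNorm (fun x => Real.exp (γ * f x)) (ENNReal.ofReal P) (roundVolume n) ≤
      ENNReal.ofReal ((roundVolume n).real Set.univ + V) ^ (1 / P) := by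
  rw [eLpNorm_eq_lintegral_rpow_enorm_toReal (by simpa using hP) ENNReal.ofReal_ne_top,
    ENNReal.toReal_ofReal hP.le]
  refine ENNReal.rpow_le_rpow ?_ (by positivity)
  have e : ∀ x, ‖Real.exp (γ * f x)‖ₑ ^ P = ENNReal.ofReal (Real.exp (P * γ * f x)) := fun x => by
    rw [Real.enorm_of_nonneg (Real.exp_pos _).le, ENNReal.ofReal_rpow_of_pos (Real.exp_pos _),
      ← Real.exp_mul]
    congr 2
    ring
  simp_rw [e]
  rw [← ofReal_integral_eq_lintegral_ofReal
    (integrable_of_continuous_sph (contMDiff_exp_mul hf.smooth _).continuous)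
    (Eventually.of_forall fun x => (Real.exp_pos _).le)]
  exact ENNReal.ofReal_le_ofReal (integral_exp_mul_le hV hf (by positivity) hPγ)

/-- Powers of `e^{f_j}` converge in `L^p` below the exponent at which the volume bounds them. -/
theorem tendsto_eLpNorm_exp_mul {n : ℕ} {V : ℝ} (hV : 0 < V) {f : ℕ → Sph n → ℝ}
    (hf : ∀ j, Admissible n V (f j)) {γ : ℝ} (hγ : 0 < γ) {w : Sph n → ℝ}
    (hw : ∀ᵐ x ∂(roundVolume n), Tendsto (fun j => Real.exp (γ * f j x)) atTop (𝓝 (w x)))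
    {p : ℝ≥0∞} (hp : 1 ≤ p) (hpγ : p < ENNReal.ofReal (n / γ)) :
    MemLp w p (roundVolume n) ∧
      Tendsto (fun j => eLpNorm ((fun x => Real.exp (γ * f j x)) - w) p (roundVolume n))
        atTop (𝓝 0) := by
  have hP : 0 < n / γ := ENNReal.ofReal_pos.1 (pos_of_gt hpγ)
  refine tendsto_eLpNorm_of_tendsto_ae_of_eLpNorm_le hp hpγ
    (M := ENNReal.ofReal ((roundVolume n).real Set.univ + V) ^ (1 / (n / γ)))
    (ENNReal.rpow_ne_top_of_nonneg (by positivity) ENNReal.ofReal_ne_top)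
    (fun j => (contMDiff_exp_mul (hf j).smooth γ).continuous.aestronglyMeasurable) hw
    fun j => eLpNorm_exp_mul_le hV (hf j) hP hγ.le (by rw [div_mul_cancel₀ _ hγ.ne'])

theorem memLp_exp_mul_smul_sphereGrad {n : ℕ} {f : Sph n → ℝ}
    (hf : ContMDiff (𝓡 n) 𝓘(ℝ, ℝ) ∞ f) (β : ℝ) :
    MemLp (fun x => Real.exp (β / 2 * f x) • sphereGrad f x) 2 (roundVolume n) :=
  memLp_of_continuous_sph
    ((contMDiff_exp_mul hf _).continuous.smul (continuous_sphereGrad hf)) 2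

theorem norm_toLp_exp_mul_smul_sphereGrad_le {n : ℕ} (hn : 3 ≤ n) {V : ℝ} (hV : 0 < V)
    {f : Sph n → ℝ} (hf : Admissible n V f) {β : ℝ} (h0 : 0 ≤ β) (hβ : 2 * β < (n : ℝ) - 2) :
    ‖(memLp_exp_mul_smul_sphereGrad hf.smooth β).toLp‖ ≤
      Real.sqrt (n * ((roundVolume n).real Set.univ + V) / ((n : ℝ) - 2 - 2 * β)) := by
  refine Real.le_sqrt_of_sq_le ?_
  rw [← real_inner_self_eq_norm_sq, L2.inner_def]
  refine le_trans (le_of_eq (integral_congr_ae ?_))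
    (integral_exp_mul_norm_sphereGrad_sq_le hn hV hf h0 hβ)
  filter_upwards [(memLp_exp_mul_smul_sphereGrad hf.smooth β).coeFn_toLp] with x hx
  rw [hx, real_inner_self_eq_norm_sq, norm_smul, Real.norm_of_nonneg (Real.exp_pos _).le, mul_pow,
    sq (Real.exp _), ← Real.exp_add]
  congr 2
  ring

/-- A nonnegative function `v` is the factor `e^{(n-2)F/2}` of some `F` with values in `[-∞, ∞)`,
namely of `2 / (n - 2) log v`, with `-∞` where `v` vanishes. -/
theorem exists_factorExt_eq {n : ℕ} (hn : 3 ≤ n) (v : Sph n → ℝ) :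
    ∃ F : Sph n → EReal, (∀ x, F x ≠ ⊤) ∧ ∀ x, 0 ≤ v x → factorExt n F x = v x := by
  have hn' : (3 : ℝ) ≤ n := by exact_mod_cast hn
  refine ⟨fun x => if 0 < v x then ((2 / ((n : ℝ) - 2) * Real.log (v x) : ℝ) : EReal) else ⊥,
    fun x => ?_, fun x hx => ?_⟩
  · simp only
    split_ifs
    · exact EReal.coe_ne_top _
    · exact bot_ne_top
  · have h2 : (n : ℝ) - 2 ≠ 0 := by linarith
    rw [factorExt]
    split_ifs with h
    · rw [← EReal.coe_mul, EReal.exp_coe, ENNReal.toReal_ofReal (Real.exp_pos _).le, ← mul_assoc,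
        div_mul_div_comm, mul_comm _ (2 : ℝ), div_self (mul_ne_zero two_ne_zero h2), one_mul,
        Real.exp_log h]
    · rw [EReal.coe_mul_bot_of_pos (by linarith), EReal.exp_bot, ENNReal.toReal_zero]
      exact le_antisymm hx (not_lt.1 h)

/-- The exponents `β_m`, tending to the critical value `(n - 2) / 2`, for which `e^{βf/2} ∇f` is
bounded in `L²`. -/
def energyExponent (n m : ℕ) : ℝ := ((n : ℝ) - 2) / 2 * (1 - 1 / ((m : ℝ) + 1))

theorem energyExponent_nonneg {n : ℕ} (hn : 3 ≤ n) (m : ℕ) : 0 ≤ energyExponent n m := by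
  have hn' : (3 : ℝ) ≤ n := by exact_mod_cast hn
  refine mul_nonneg (by linarith) (sub_nonneg.2 ?_)
  rw [div_le_one (by positivity)]
  linarith [Nat.cast_nonneg (α := ℝ) m]

theorem two_mul_energyExponent_lt {n : ℕ} (hn : 3 ≤ n) (m : ℕ) :
    2 * energyExponent n m < (n : ℝ) - 2 := by
  have hn' : (3 : ℝ) ≤ n := by exact_mod_cast hn
  have : 0 < ((n : ℝ) - 2) * (1 / ((m : ℝ) + 1)) := by
    have : 0 < (n : ℝ) - 2 := by linarith
    positivity
  rw [energyExponent]
  linarith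

/-- Below the critical exponent, `L^r · L² ⊂ L^q` for an exponent `r` for which the remaining power
of `e^f` converges in `L^r`. -/
theorem exists_holderTriple {n : ℕ} (hn : 3 ≤ n) {q : ℝ≥0∞} (hq1 : 1 ≤ q)
    (hq : q < ENNReal.ofReal (4 * (n : ℝ) / (3 * (n : ℝ) - 2))) :
    ∃ (m : ℕ) (r : ℝ≥0∞), 1 ≤ r ∧ ENNReal.HolderTriple r 2 q ∧
      r < ENNReal.ofReal (n / (((n : ℝ) - 2 - energyExponent n m) / 2)) := by
  have hn' : (3 : ℝ) ≤ n := by exact_mod_cast hn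
  have hqt : q ≠ ⊤ := (hq.trans_le le_top).ne
  obtain ⟨s, rfl⟩ : ∃ s : ℝ, q = ENNReal.ofReal s := ⟨q.toReal, (ENNReal.ofReal_toReal hqt).symm⟩
  rw [ENNReal.one_le_ofReal] at hq1
  have hs := (ENNReal.ofReal_lt_ofReal_iff_of_nonneg (by linarith)).1 hq
  rw [lt_div_iff₀ (by linarith)] at hs
  -- `ρ = 1 / r`; the requirement is `(n - 2 - β_m) / 2 < nρ`, whose left hand side decreases to
  -- `(n - 2) / 4` as `m` grows.
  set ρ : ℝ := 1 / s - 1 / 2 with hρ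
  have hδ : 0 < n * ρ - ((n : ℝ) - 2) / 4 := by
    have h : (3 * (n : ℝ) - 2) / 4 < n * (1 / s) := by
      rw [mul_one_div, lt_div_iff₀ (by linarith)]
      linarith
    rw [hρ]
    linarith
  have hρ0 : 0 < ρ := by
    by_contra! h
    nlinarith
  have hρ1 : ρ ≤ 1 := by
    have : 1 / s ≤ 1 := (div_le_one (by linarith)).2 hq1
    linarith
  obtain ⟨m, hm⟩ := exists_nat_one_div_lt
    (show 0 < (n * ρ - ((n : ℝ) - 2) / 4) / (((n : ℝ) - 2) / 4) from
      div_pos hδ (by linarith))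
  refine ⟨m, ENNReal.ofReal ρ⁻¹, ?_, ⟨?_⟩, ?_⟩
  · rw [ENNReal.one_le_ofReal]
    exact (one_le_inv₀ hρ0).2 hρ1
  · have h2 : (2 : ℝ≥0∞)⁻¹ = ENNReal.ofReal (1 / 2) := by
      rw [one_div, ENNReal.ofReal_inv_of_pos (by norm_num), ENNReal.ofReal_ofNat]
    rw [← ENNReal.ofReal_inv_of_pos (inv_pos.2 hρ0), inv_inv, h2,
      ← ENNReal.ofReal_inv_of_pos (by linarith), ← ENNReal.ofReal_add hρ0.le (by norm_num), hρ]
    congr 1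
    ring
  · rw [lt_div_iff₀ (by linarith)] at hm
    have h3 : ((n : ℝ) - 2 - energyExponent n m) / 2 < n * ρ := by
      rw [energyExponent]
      linarith
    have h4 : 0 < ((n : ℝ) - 2 - energyExponent n m) / 2 := by
      linarith [two_mul_energyExponent_lt hn m]
    refine (ENNReal.ofReal_lt_ofReal_iff_of_nonneg (by positivity)).2 ?_
    rw [lt_div_iff₀ h4, inv_mul_lt_iff₀ hρ0]
    linarith

/-- The gradient of `e^{(n-2)f_j/2}` is the product of a power of `e^{f_j}`, which converges
strongly, and of `e^{βf_j/2} ∇f_j`, which converges weakly in `L²`. -/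
theorem tendstoWeaklySobolev_factor {n : ℕ} (hn : 3 ≤ n) {V : ℝ} (hV : 0 < V)
    {f : ℕ → Sph n → ℝ} (hf : ∀ j, Admissible n V (f j)) {v : Sph n → ℝ}
    (hv : ∀ᵐ x ∂(roundVolume n), Tendsto (fun j => factor n (f j) x) atTop (𝓝 (v x)))
    {G : ℕ → Lp (Amb n) 2 (roundVolume n)}
    (hG : ∀ m y, Tendsto (fun j =>
      ⟪(memLp_exp_mul_smul_sphereGrad (hf j).smooth (energyExponent n m)).toLp, y⟫) atTop
      (𝓝 ⟪G m, y⟫)) {q : ℝ≥0∞} [hq1 : Fact (1 ≤ q)]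
    (hq : q < ENNReal.ofReal (4 * (n : ℝ) / (3 * (n : ℝ) - 2))) :
    TendstoWeaklySobolev n q (fun j => factor n (f j)) v := by
  have hn' : (3 : ℝ) ≤ n := by exact_mod_cast hn
  obtain ⟨m, r, hr1, hH, hr⟩ := exists_holderTriple hn hq1.out hq
  have : Fact (1 ≤ r) := ⟨hr1⟩
  have hβ := two_mul_energyExponent_lt hn m
  set β := energyExponent n m
  set γ : ℝ := ((n : ℝ) - 2 - β) / 2 with hγ
  have hγ0 : 0 < γ := by linarith [energyExponent_nonneg hn m]
  -- The power of `e^{f_j}` converges, being a power of `e^{(n-2)f_j/2}`.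
  have ha : ∀ᵐ x ∂(roundVolume n), Tendsto (fun j => Real.exp (γ * f j x)) atTop
      (𝓝 (v x ^ (γ / (((n : ℝ) - 2) / 2)))) := by
    filter_upwards [hv] with x hx
    have h := (Real.continuousAt_rpow_const (v x) (γ / (((n : ℝ) - 2) / 2))
      (Or.inr (div_nonneg hγ0.le (by linarith)))).tendsto.comp hx
    refine h.congr fun j => ?_
    simp only [Function.comp, factor]
    rw [← Real.exp_mul]
    congr 1
    have : (n : ℝ) - 2 ≠ 0 := by linarith
    field_simp
  obtain ⟨hav, hal⟩ := tendsto_eLpNorm_exp_mul hV hf hγ0 ha hr1 hr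
  have ham : ∀ j, MemLp (fun x => Real.exp (γ * f j x)) r (roundVolume n) := fun j =>
    memLp_of_continuous_sph (contMDiff_exp_mul (hf j).smooth γ).continuous r
  have haL := (Lp.tendsto_Lp_iff_tendsto_eLpNorm'' _ ham _ hav).2 hal
  have hqu : q < ENNReal.ofReal (n / (((n : ℝ) - 2) / 2)) := by
    refine hq.trans_le (ENNReal.ofReal_le_ofReal ?_)
    rw [div_le_div_iff₀ (by linarith) (by linarith)]
    nlinarith
  obtain ⟨hvq, hul⟩ := tendsto_eLpNorm_exp_mul hV hf (by linarith) hv hq1.out hqu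
  have hum : ∀ j, MemLp (factor n (f j)) q (roundVolume n) := fun j =>
    memLp_of_continuous_sph (contMDiff_factor (hf j).smooth).continuous q
  have huL := (Lp.tendsto_Lp_iff_tendsto_eLpNorm'' _ hum _ hvq).2 hul
  set T : Lp ℝ r (roundVolume n) →L[ℝ] Lp (Amb n) 2 (roundVolume n) →L[ℝ]
    Lp (Amb n) q (roundVolume n) :=
    (ContinuousLinearMap.lsmul ℝ ℝ).holderL (roundVolume n) r 2 q with hT
  set X : ℕ → Lp (Amb n) q (roundVolume n) := fun j => (((n : ℝ) - 2) / 2) •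
    T (ham j).toLp (memLp_exp_mul_smul_sphereGrad (hf j).smooth β).toLp with hX
  set X' : Lp (Amb n) q (roundVolume n) := (((n : ℝ) - 2) / 2) • T hav.toLp (G m) with hX'
  have hXl : ∀ ℓ : StrongDual ℝ (Lp (Amb n) q (roundVolume n)),
      Tendsto (fun j => ℓ (X j)) atTop (𝓝 (ℓ X')) := by
    intro ℓ
    have h := tendsto_bilinear_of_tendsto_of_weak
      ((ContinuousLinearMap.compL ℝ _ _ _ ℓ).comp T) haL
      (fun j => norm_toLp_exp_mul_smul_sphereGrad_le hn hV (hf j) (energyExponent_nonneg hn m) hβ)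
      (hG m)
    simpa [hX, hX'] using h.const_mul (((n : ℝ) - 2) / 2)
  have hXg : ∀ j, sphereGrad (factor n (f j)) =ᵐ[roundVolume n] X j := by
    intro j
    filter_upwards [Lp.coeFn_smul (((n : ℝ) - 2) / 2)
        (T (ham j).toLp (memLp_exp_mul_smul_sphereGrad (hf j).smooth β).toLp),
      (ContinuousLinearMap.lsmul ℝ ℝ).coeFn_holder (r := q) (ham j).toLp
        (memLp_exp_mul_smul_sphereGrad (hf j).smooth β).toLp,
      (ham j).coeFn_toLp, (memLp_exp_mul_smul_sphereGrad (hf j).smooth β).coeFn_toLp]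
      with x h1 h2 h3 h4
    rw [sphereGrad_factor (hf j).smooth β, hX]
    simp only
    rw [h1, Pi.smul_apply, hT, ContinuousLinearMap.holderL_apply_apply, h2, h3, h4, mul_smul]
    rfl
  have hwg : ∀ j, IsWeakGrad (hum j).toLp (X j) := fun j =>
    (isWeakGrad_sphereGrad (contMDiff_factor (hf j).smooth)).congr (hum j).coeFn_toLp.symm (hXg j)
  exact ⟨fun j => ⟨((hum j).toLp, X j), hwg j⟩,
    ⟨(hvq.toLp, X'), isWeakGrad_of_tendsto hwg huL hXl⟩, fun j => (hum j).coeFn_toLp,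
    hvq.coeFn_toLp, tendsto_toWeakSpace_submodule_prod huL hXl⟩

/-- Compactness of the conformal factors: one subsequence converges almost everywhere, and along it
`e^{βf_j/2} ∇f_j` converges weakly in `L²` for all the exponents `β_m`. -/
theorem exists_subseq_tendsto_factor {n : ℕ} (hn : 3 ≤ n) {V : ℝ} (hV : 0 < V)
    {f : ℕ → Sph n → ℝ} (hf : ∀ j, Admissible n V (f j)) :
    ∃ (φ : ℕ → ℕ) (F : Sph n → EReal), StrictMono φ ∧ (∀ x, F x ≠ ⊤) ∧
      (∀ (q : ℝ≥0∞) [Fact (1 ≤ q)], q < ENNReal.ofReal (4 * (n : ℝ) / (3 * (n : ℝ) - 2)) →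
        TendstoWeaklySobolev n q (fun j => factor n (f (φ j))) (factorExt n F)) ∧
      ∀ p : ℝ≥0∞, 1 ≤ p → p < ENNReal.ofReal (2 * (n : ℝ) / ((n : ℝ) - 2)) →
        TendstoLp n p (fun j => factor n (f (φ j))) (factorExt n F) := by
  have hn' : (3 : ℝ) ≤ n := by exact_mod_cast hn
  obtain ⟨C, hC⟩ := exists_integral_norm_sphereGrad_factor_rpow_le hn hV (le_refl (1 : ℝ))
    (by rw [lt_div_iff₀ (by linarith)]; linarith)
  simp only [Real.rpow_one] at hC
  obtain ⟨φ, v, hφ, -, hv⟩ := exists_subseq_tendsto_ae (u := fun j => factor n (f j))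
    (C := max C ((roundVolume n).real Set.univ + V)) (fun j => contMDiff_factor (hf j).smooth)
    (fun j => by
      refine le_trans (le_of_eq ?_) ((integral_exp_mul_le hV (hf j) (β := (n : ℝ) - 2)
        (by linarith) (by linarith)).trans (le_max_right _ _))
      refine integral_congr_ae (Eventually.of_forall fun x => ?_)
      simp only [factor]
      rw [sq, ← Real.exp_add]
      congr 1
      ring)
    (fun j => (hC _ (hf j)).2.trans (le_max_left _ _))
  have : Fact ((2 : ℝ≥0∞) ≠ ⊤) := ⟨ENNReal.ofNat_ne_top⟩
  have : MeasurableSpace.CountablyGenerated (Sph n) :=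
    inferInstanceAs (MeasurableSpace.CountablyGenerated (Metric.sphere (0 : Amb n) 1))
  have : TopologicalSpace.SeparableSpace (Lp (Amb n) 2 (roundVolume n)) := inferInstance
  obtain ⟨ψ, hψ, G, hG⟩ := exists_subseq_tendsto_inner
    (F := fun m j => (memLp_exp_mul_smul_sphereGrad (hf (φ j)).smooth (energyExponent n m)).toLp)
    fun m j => norm_toLp_exp_mul_smul_sphereGrad_le hn hV (hf (φ j)) (energyExponent_nonneg hn m)
      (two_mul_energyExponent_lt hn m)
  obtain ⟨F, hF, hFv⟩ := exists_factorExt_eq hn v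
  have hvF : ∀ᵐ x ∂(roundVolume n),
      Tendsto (fun j => factor n (f (φ (ψ j))) x) atTop (𝓝 (factorExt n F x)) := by
    filter_upwards [hv] with x hx
    rw [hFv x (ge_of_tendsto' hx fun j => (Real.exp_pos _).le)]
    exact hx.comp hψ.tendsto_atTop
  refine ⟨φ ∘ ψ, F, hφ.comp hψ, hF, fun q _ hq => ?_, fun p hp hpn => ?_⟩
  · exact tendstoWeaklySobolev_factor hn hV (fun j => hf (φ (ψ j))) hvF hG hq
  · have hpn' : p < ENNReal.ofReal (n / (((n : ℝ) - 2) / 2)) := by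
      rwa [div_div_eq_mul_div, mul_comm (n : ℝ) 2]
    obtain ⟨h1, h2⟩ := tendsto_eLpNorm_exp_mul hV (fun j => hf (φ (ψ j))) (by linarith) hvF hp hpn'
    exact ⟨fun j => memLp_of_continuous_sph
      (contMDiff_factor (hf (φ (ψ j))).smooth).continuous p, h1, h2⟩

end ConformalSphere

end

theorem mainTheorem6 (n : ℕ) (hn : 3 ≤ n) (V : ℝ) (hV : 0 < V) :
    (∀ q : ℝ, 1 ≤ q → q < 4 * (n : ℝ) / (3 * (n : ℝ) - 2) →
      ∃ C : ℝ, ∀ f : Sph n → ℝ,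
        ContMDiff (𝓡 n) 𝓘(ℝ, ℝ) ∞ f →
        (∀ x, 0 ≤ scalarCurvature (conformalMetric n f) x) →
        totalVolume (conformalMetric n f) ≤ ENNReal.ofReal V →
        Integrable (fun x => ‖sphereGrad (factor n f) x‖ ^ q) (roundVolume n) ∧
          ∫ x, ‖sphereGrad (factor n f) x‖ ^ q ∂(roundVolume n) ≤ C) ∧
    (∀ f : ℕ → Sph n → ℝ,
      (∀ j, ContMDiff (𝓡 n) 𝓘(ℝ, ℝ) ∞ (f j)) →
      (∀ j x, 0 ≤ scalarCurvature (conformalMetric n (f j)) x) →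
      (∀ j, totalVolume (conformalMetric n (f j)) ≤ ENNReal.ofReal V) →
      ∃ (φ : ℕ → ℕ) (fLim : Sph n → EReal),
        StrictMono φ ∧ (∀ x, fLim x ≠ ⊤) ∧
        (∀ (q : ℝ≥0∞) [Fact (1 ≤ q)],
          q < ENNReal.ofReal (4 * (n : ℝ) / (3 * (n : ℝ) - 2)) →
          TendstoWeaklySobolev n q (fun j => factor n (f (φ j))) (factorExt n fLim)) ∧
        (∀ p : ℝ≥0∞, 1 ≤ p → p < ENNReal.ofReal (2 * (n : ℝ) / ((n : ℝ) - 2)) →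
          TendstoLp n p (fun j => factor n (f (φ j))) (factorExt n fLim))) := by
  refine ⟨fun q hq1 hq => ?_, fun f hf hx hvol => ?_⟩
  · obtain ⟨C, hC⟩ := exists_integral_norm_sphereGrad_factor_rpow_le hn hV hq1 hq
    exact ⟨C, fun f hf hx hvol => hC f ⟨hf, hx, hvol⟩⟩
  · exact exists_subseq_tendsto_factor hn hV fun j => ⟨hf j, hx j, hvol j⟩
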